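/- **Setting.** Let $\mathcal T$ be a finite tree with edges $e_j$ ($j\in J$) of lengths $\ell_j>0$, each identified with $[0,\ell_j]$ by arc length, and vertices $a_k$. Let the root $\mathcal R=a_1$ be an exterior vertex (a vertex lying on exactly one edge), let $I_{\mathcal M}$ index the interior vertices (those lying on more than one edge) and $I_{\mathcal S}$ the exterior vertices other than $\mathcal R$. Let $J_k$ be the set of edges adjacent to $a_k$, with $J_k=\{j_k\}$ for $k\in I_{\mathcal S}$, and let $d_{kj}=1$ if $a_k$ is the end $x=\ell_j$ of $e_j$, $d_{kj}=-1$ if it is the end $x=0$, and $d_{kj}=0$ otherwise. Consider the system $$\begin{cases} y^j_{tt}-y^j_{xx}=0 \ \text{ in } (0,\ell_j)\times(0,\infty),\ j\in J,\\ \sum_{j\in J_k} d_{kj}\,y^j_x(a_k,t)=s_k'(t),\quad s_k''(t)+s_k(t)=-y_t(a_k,t),\quad k\in I_{\mathcal M},\\ y^j(a_k,t)=y^l(a_k,t),\ \ j,l\in J_k,\ k\in I_{\mathcal M},\qquad y(\mathcal R,t)=0,\\ d_{kj_k}\,y_x^{j_k}(a_k,t)=-y_t(a_k,t),\ \ k\in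 I_{\mathcal S},\\ (y,y_t,s,s')(0)=(y_0,y_1,s^0,s^1).\end{cases}\tag{1.1}$$ Let $V$ be the space of all $\Phi\in\prod_j H^1(0,\ell_j)$ that vanish at $\mathcal R$ and are continuous at the interior vertices, and let $H=V\times\prod_jL^2(0,\ell_j)\times(\mathbb C^{I_{\mathcal M}})^2$ be the Hilbert space with norm $$\|(y,v,p,q)\|_H^2=\sum_j\big(\|y^j_x\|^2_{L^2}+\|v^j\|^2_{L^2}\big)+\sum_{k\in I_{\mathcal M}}\big(|p_k|^2+|q_k|^2\big),\qquad E=\tfrac12\|\cdot\|_H^2 .$$ Let $\mathcal A(y,v,p,q)=\big(v,\,y_{xx},\,q,\,(-p_k-v(a_k))_{k\in I_{\mathcal M}}\big)$, with domain $\mathcal D(\mathcal A)$ consisting of all $(y,v,p,q)$ with $y\in V\cap\prod_jH^2(0,\ell_j)$, $v\in V$, $\sum_{j\in J_k}d_{kj}y^j_x(a_k)=q_k$ for $k\in I_{\mathcal M}$ and $d_{kj_k}y_x^{j_k}(a_k)=-v(a_k)$ for $k\in I_{\mathcal S}$. With $z=(y,y_t,s,s')$, the system (1.1) is $z'=\mathcal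 Az$, $z(0)=z_0$. A solution in $C([0,\infty);H)$ is understood in the integrated (mild) sense: $\int_0^tz\in\mathcal D(\mathcal A)$ and $z(t)=z_0+\mathcal A\int_0^tz(s)\,ds$ for all $t\ge0$. **Proposition (wellposedness).** 1. For every $z_0=(y_0,y_1,s^0,s^1)\in H$, problem (1.1) has a unique solution $z=(y,y_t,s,s')\in C([0,\infty);H)$. 2. This solution satisfies the energy identity $$E(0)-E(t)=\sum_{k\in I_{\mathcal S}}\int_0^t|y_t(a_k,s)|^2\,ds,\qquad t\ge 0,\tag{1.3}$$ where for every $k\in I_{\mathcal S}$ the function $t\mapsto y(a_k,t)$ is locally absolutely continuous on $[0,\infty)$, with derivative $y_t(a_k,\cdot)\in L^2(0,t)$ for all $t\geq 0$. 3. If $z_0\in\mathcal D(\mathcal A)$, then $z\in C([0,\infty);\mathcal D(\mathcal A))\cap C^1([0,\infty);H)$ (with the graph norm on $\mathcal D(\mathcal A)$) and $z'=\mathcal Az$, $z(0)=z_0$ holds for all $t\ge0$; in this case $y_t(\cdot,t)\in V$ for all $t\ge 0$, and (1.3) also holds with $y_t(a_k,s)$ read as the value at $a_k$ of $y_t(\cdot,s)\in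 V$. 4. The operator $\mathcal A$ generates a $C_0$-semigroup of contractions $(S(t))_{t\ge0}$ on $H$, and the solution of (1.1) is $z(t)=S(t)z_0$. -/

import Mathlib

open MeasureTheory Set Filter Topology

noncomputable section

/-- A finite metric tree with a root. The edges are those of the simple graph `graph`; the edge `e`
is identified with the interval `[0, len e]`, its end `x = 0` being the vertex `init e` and its end
`x = len e` the vertex `term e`. The root is an exterior vertex: it lies on exactly one edge. -/
structure RootedMetricTree (V : Type*) where
  graph : SimpleGraph V
  isTree : graph.IsTree
  init : graph.edgeSet → V
  term : graph.edgeSet → V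
  ends : ∀ e, s(init e, term e) = (e : Sym2 V)
  len : graph.edgeSet → ℝ
  len_pos : ∀ e, 0 < len e
  root : V
  root_exterior : {e : graph.edgeSet | root ∈ (e : Sym2 V)}.ncard = 1

namespace RootedMetricTree

/-- `L²(0, ℓ)`, complex valued. -/
abbrev L2 (ℓ : ℝ) : Type := Lp ℂ 2 (volume.restrict (Ioo (0 : ℝ) ℓ))

lemma integrable_L2 {ℓ : ℝ} (w : L2 ℓ) : IntegrableOn (w : ℝ → ℂ) (Ioo 0 ℓ) :=
  (Lp.memLp w).integrable (by norm_num)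

lemma intervalIntegrable_L2 {ℓ : ℝ} (w : L2 ℓ) {x : ℝ} (hx : x ∈ Icc 0 ℓ) :
    IntervalIntegrable (w : ℝ → ℂ) volume 0 x := by
  rw [intervalIntegrable_iff_integrableOn_Ioo_of_le hx.1]
  exact (integrable_L2 w).mono_set (Ioo_subset_Ioo_right hx.2)

lemma integral_congr_L2 {ℓ : ℝ} {f g : ℝ → ℂ} (h : f =ᵐ[volume.restrict (Ioo 0 ℓ)] g) {x : ℝ}
    (hx : x ∈ Icc 0 ℓ) : ∫ s in (0 : ℝ)..x, f s = ∫ s in (0 : ℝ)..x, g s := by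
  rw [intervalIntegral.integral_of_le hx.1, intervalIntegral.integral_of_le hx.1,
    integral_Ioc_eq_integral_Ioo, integral_Ioc_eq_integral_Ioo]
  exact integral_congr_ae (ae_restrict_of_ae_restrict_of_subset (Ioo_subset_Ioo_right hx.2) h)

lemma integral_add_L2 {ℓ : ℝ} (w w' : L2 ℓ) {x : ℝ} (hx : x ∈ Icc 0 ℓ) :
    ∫ s in (0 : ℝ)..x, (w + w' : L2 ℓ) s
      = (∫ s in (0 : ℝ)..x, w s) + ∫ s in (0 : ℝ)..x, w' s := by
  rw [integral_congr_L2 (Lp.coeFn_add w w') hx, ← intervalIntegral.integral_add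
    (intervalIntegrable_L2 w hx) (intervalIntegrable_L2 w' hx)]
  rfl

lemma integral_smul_L2 {ℓ : ℝ} (c : ℂ) (w : L2 ℓ) {x : ℝ} (hx : x ∈ Icc 0 ℓ) :
    ∫ s in (0 : ℝ)..x, (c • w : L2 ℓ) s = c * ∫ s in (0 : ℝ)..x, w s := by
  rw [integral_congr_L2 (Lp.coeFn_smul c w) hx, ← intervalIntegral.integral_const_mul]
  rfl

lemma integral_zero_L2 {ℓ : ℝ} {x : ℝ} (hx : x ∈ Icc 0 ℓ) :
    ∫ s in (0 : ℝ)..x, (0 : L2 ℓ) s = 0 := by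
  rw [integral_congr_L2 (Lp.coeFn_zero ℂ 2 _) hx]
  simp

/-- The Sobolev space `H¹(0, ℓ)`: the absolutely continuous functions on `[0, ℓ]` with derivative in
`L²(0, ℓ)`. An element is a pair `(u, w)`: the continuous representative `u` of the function
(given the value `0` outside `[0, ℓ]`) and the class `w = u'` of its derivative. -/
def H1 (ℓ : ℝ) : Submodule ℂ ((ℝ → ℂ) × L2 ℓ) where
  carrier := {p | (∀ x ∈ Icc 0 ℓ, p.1 x = p.1 0 + ∫ s in (0 : ℝ)..x, p.2 s) ∧
    ∀ x ∉ Icc 0 ℓ, p.1 x = 0}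
  zero_mem' := ⟨fun x hx => by
    simpa using (integral_zero_L2 hx).symm, fun x _ => rfl⟩
  add_mem' := by
    rintro p q ⟨hp, hp'⟩ ⟨hq, hq'⟩
    refine ⟨fun x hx => ?_, fun x hx => by simp [hp' x hx, hq' x hx]⟩
    simp only [Prod.fst_add, Prod.snd_add, Pi.add_apply]
    rw [integral_add_L2 _ _ hx, hp x hx, hq x hx]
    ring
  smul_mem' := by
    rintro c p ⟨hp, hp'⟩
    refine ⟨fun x hx => ?_, fun x hx => by simp [hp' x hx]⟩
    simp only [Prod.smul_fst, Prod.smul_snd, Pi.smul_apply, smul_eq_mul]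
    rw [integral_smul_L2 _ _ hx, hp x hx]
    ring

/-- The function underlying an element of `H¹(0, ℓ)`. -/
def H1.fn {ℓ : ℝ} (u : H1 ℓ) : ℝ → ℂ := u.1.1

/-- The derivative of an element of `H¹(0, ℓ)`. -/
def H1.deriv {ℓ : ℝ} (u : H1 ℓ) : L2 ℓ := u.1.2

lemma continuous_integral_L2 {ℓ x : ℝ} (hx : x ∈ Icc 0 ℓ) :
    Continuous fun w : L2 ℓ => ∫ s in (0 : ℝ)..x, w s := by
  have hs : (volume.restrict (Ioo (0 : ℝ) ℓ)) (Ioo 0 x) ≠ ⊤ := measure_ne_top _ _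
  have h : ∀ w : L2 ℓ, ∫ s in (0 : ℝ)..x, w s
      = inner ℂ (indicatorConstLp 2 (measurableSet_Ioo (a := (0 : ℝ)) (b := x)) hs (1 : ℂ)) w := by
    intro w
    rw [L2.inner_indicatorConstLp_one, Measure.restrict_restrict measurableSet_Ioo,
      inter_eq_left.2 (Ioo_subset_Ioo_right hx.2), intervalIntegral.integral_of_le hx.1,
      integral_Ioc_eq_integral_Ioo]
  simp only [h]
  exact continuous_const.inner continuous_id

lemma H1.fn_eq {ℓ : ℝ} (u : H1 ℓ) {x : ℝ} (hx : x ∈ Icc 0 ℓ) :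
    H1.fn u x = H1.fn u 0 + ∫ s in (0 : ℝ)..x, H1.deriv u s := u.2.1 x hx

lemma H1.continuousOn_fn {ℓ : ℝ} (hl : 0 ≤ ℓ) (u : H1 ℓ) : ContinuousOn (H1.fn u) (Icc 0 ℓ) := by
  have h : ContinuousOn (fun x => ∫ s in (0 : ℝ)..x, H1.deriv u s) (Icc 0 ℓ) := by
    rw [← uIcc_of_le hl]
    exact intervalIntegral.continuousOn_primitive_interval'
      (intervalIntegrable_L2 _ ⟨hl, le_rfl⟩) left_mem_uIcc
  exact (continuousOn_const.add h).congr fun x hx => H1.fn_eq u hx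

/-- The continuous representative and the derivative are determined by the class of the function. -/
lemma H1.eq_zero_of_ae {ℓ : ℝ} (hl : 0 < ℓ) (u : H1 ℓ)
    (h : H1.fn u =ᵐ[volume.restrict (Ioo 0 ℓ)] 0) : u = 0 := by
  have h0 : EqOn (H1.fn u) 0 (Icc 0 ℓ) := by
    refine Measure.eqOn_Icc_of_ae_eq volume hl.ne ?_ (H1.continuousOn_fn hl.le u) continuousOn_const
    rwa [← Measure.restrict_congr_set Ioo_ae_eq_Icc]
  have hint : ∀ x ∈ Icc 0 ℓ, ∫ s in (0 : ℝ)..x, H1.deriv u s = 0 := by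
    intro x hx
    have h1 := H1.fn_eq u hx
    rw [h0 hx, h0 ⟨le_rfl, hl.le⟩] at h1
    simpa using h1.symm
  have hd : H1.deriv u = 0 := by
    rw [Lp.eq_zero_iff_ae_eq_zero]
    have hii := intervalIntegrable_L2 (H1.deriv u) (x := ℓ) ⟨hl.le, le_rfl⟩
    rw [EventuallyEq, ae_restrict_iff' measurableSet_Ioo]
    filter_upwards [hii.ae_hasDerivAt_integral] with x hx hx'
    have hxm : x ∈ uIcc 0 ℓ := by
      rw [uIcc_of_le hl.le]
      exact Ioo_subset_Icc_self hx'
    have h1 := hx hxm 0 left_mem_uIcc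
    have h2 : HasDerivAt (fun y => ∫ s in (0 : ℝ)..y, H1.deriv u s) 0 x := by
      refine (hasDerivAt_const x (0 : ℂ)).congr_of_eventuallyEq ?_
      filter_upwards [Ioo_mem_nhds hx'.1 hx'.2] with y hy
      exact hint y (Ioo_subset_Icc_self hy)
    exact h1.unique h2
  refine Subtype.ext (Prod.ext (funext fun x => ?_) hd)
  by_cases hx : x ∈ Icc 0 ℓ
  · exact h0 hx
  · exact u.2.2 x hx

variable {V : Type*} (T : RootedMetricTree V)

/-- The set of edges of the tree. -/
abbrev Edge : Type _ := T.graph.edgeSet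

instance [Finite V] : Fintype T.Edge := Fintype.ofFinite _

/-- The set of edges adjacent to the vertex `k`. -/
def adjEdges (k : V) : Set T.Edge := {e | k ∈ (e : Sym2 V)}

/-- The interior vertices: those whose multiplicity is not one. -/
def IsInterior (k : V) : Prop := (T.adjEdges k).ncard ≠ 1

/-- The exterior vertices other than the root. -/
def IsLeaf (k : V) : Prop := (T.adjEdges k).ncard = 1 ∧ k ≠ T.root

/-- The interior vertices, occupied by the point masses. -/
abbrev Mass : Type _ := {k : V // T.IsInterior k}

/-- The exterior vertices other than the root, where the feedbacks act. -/
abbrev Leaf : Type _ := {k : V // T.IsLeaf k}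

instance [Finite V] : Fintype T.Mass := Fintype.ofFinite _

instance [Finite V] : Fintype T.Leaf := Fintype.ofFinite _

open Classical in
/-- The coordinate in `[0, len e]` of the vertex `k`, for an edge `e` adjacent to `k`. -/
def coord (e : T.Edge) (k : V) : ℝ := if T.term e = k then T.len e else 0

open Classical in
/-- The incidence matrix. -/
def incidence (k : V) (e : T.Edge) : ℂ :=
  if T.term e = k then 1 else if T.init e = k then -1 else 0

lemma adjEdges_nonempty (k : V) : (T.adjEdges k).Nonempty := by
  have h1 : (T.adjEdges T.root).Nonempty := by
    apply Set.nonempty_of_ncard_ne_zero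
    exact ne_of_eq_of_ne T.root_exterior one_ne_zero
  obtain ⟨e, -⟩ := h1
  have hadj : T.graph.Adj (T.init e) (T.term e) := by
    rw [← SimpleGraph.mem_edgeSet, T.ends e]
    exact e.2
  have : Nontrivial V := ⟨_, _, hadj.ne⟩
  obtain ⟨l, hl⟩ := T.isTree.1.preconnected.exists_adj_of_nontrivial k
  exact ⟨⟨s(k, l), hl⟩, Sym2.mem_mk_left k l⟩

/-- An edge adjacent to the vertex `k` (the only one when `k` is exterior). -/
def edgeAt (k : V) : T.Edge := (T.adjEdges_nonempty k).some

/-- The space `V` of the families `(y_e)` in `∏ H¹(0, len e)` that vanish at the root and are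
continuous at the interior vertices. -/
def V₀ : Submodule ℂ (∀ e : T.Edge, H1 (T.len e)) where
  carrier := {y | (∀ e ∈ T.adjEdges T.root, H1.fn (y e) (T.coord e T.root) = 0) ∧
    ∀ k, T.IsInterior k → ∀ e ∈ T.adjEdges k, ∀ e' ∈ T.adjEdges k,
      H1.fn (y e) (T.coord e k) = H1.fn (y e') (T.coord e' k)}
  zero_mem' := ⟨fun _ _ => rfl, fun _ _ _ _ _ _ => rfl⟩
  add_mem' := by
    rintro y z ⟨hy, hy'⟩ ⟨hz, hz'⟩
    refine ⟨fun e he => ?_, fun k hk e he e' he' => ?_⟩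
    · exact (congrArg₂ (· + ·) (hy e he) (hz e he)).trans (add_zero 0)
    · exact congrArg₂ (· + ·) (hy' k hk e he e' he') (hz' k hk e he e' he')
  smul_mem' := by
    rintro c y ⟨hy, hy'⟩
    refine ⟨fun e he => ?_, fun k hk e he e' he' => ?_⟩
    · exact (congrArg (c * ·) (hy e he)).trans (mul_zero c)
    · exact congrArg (c * ·) (hy' k hk e he e' he')

/-- The space `V`, as a type of its own: it will carry the norm `(∑ ‖y_e'‖²)^(1/2)`. -/
def VSpace : Type _ := T.V₀

instance : AddCommGroup T.VSpace := inferInstanceAs (AddCommGroup T.V₀)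

instance : Module ℂ T.VSpace := inferInstanceAs (Module ℂ T.V₀)

namespace VSpace

variable {T}

/-- The component of `y` on the edge `e`. -/
def comp (y : T.VSpace) (e : T.Edge) : H1 (T.len e) := y.1 e

/-- The function `y^e` on the edge `e`. -/
def fn (y : T.VSpace) (e : T.Edge) : ℝ → ℂ := H1.fn (y.comp e)

/-- The derivative `dy^e/dx`. -/
def deriv (y : T.VSpace) (e : T.Edge) : L2 (T.len e) := H1.deriv (y.comp e)

/-- The value `y(a_k)` at the vertex `k`. -/
def val (y : T.VSpace) (k : V) : ℂ := y.fn (T.edgeAt k) (T.coord (T.edgeAt k) k)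

lemma fn_add (y z : T.VSpace) (e : T.Edge) : (y + z).fn e = y.fn e + z.fn e := rfl

lemma fn_smul (c : ℂ) (y : T.VSpace) (e : T.Edge) : (c • y).fn e = c • y.fn e := rfl

lemma fn_zero (e : T.Edge) : (0 : T.VSpace).fn e = 0 := rfl

lemma val_add (y z : T.VSpace) (k : V) : (y + z).val k = y.val k + z.val k := rfl

lemma val_smul (c : ℂ) (y : T.VSpace) (k : V) : (c • y).val k = c * y.val k := rfl

lemma val_zero (k : V) : (0 : T.VSpace).val k = 0 := rfl

lemma fn_eq (y : T.VSpace) (e : T.Edge) {x : ℝ} (hx : x ∈ Icc 0 (T.len e)) :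
    y.fn e x = y.fn e 0 + ∫ s in (0 : ℝ)..x, y.deriv e s := (y.comp e).2.1 x hx

lemma fn_outside (y : T.VSpace) (e : T.Edge) {x : ℝ} (hx : x ∉ Icc 0 (T.len e)) :
    y.fn e x = 0 := (y.comp e).2.2 x hx

lemma ext_fn {y z : T.VSpace} (hf : ∀ e, y.fn e = z.fn e) (hd : ∀ e, y.deriv e = z.deriv e) :
    y = z :=
  Subtype.ext (funext fun e => Subtype.ext (Prod.ext (hf e) (hd e)))

lemma fn_coord (y : T.VSpace) {k : V} {e : T.Edge} (he : e ∈ T.adjEdges k) :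
    y.fn e (T.coord e k) = y.val k := by
  by_cases hk : T.IsInterior k
  · exact y.2.2 k hk e he _ (T.adjEdges_nonempty k).some_mem
  · have h1 : (T.adjEdges k).ncard = 1 := not_not.1 hk
    obtain ⟨a, ha⟩ := Set.ncard_eq_one.1 h1
    have h2 : T.edgeAt k ∈ T.adjEdges k := (T.adjEdges_nonempty k).some_mem
    rw [ha, mem_singleton_iff] at he h2
    rw [val, h2, he]

lemma val_root (y : T.VSpace) : y.val T.root = 0 :=
  y.2.1 _ (T.adjEdges_nonempty T.root).some_mem

/-- The vector of the derivatives, as a linear map. -/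
def derivₗ [Finite V] : T.VSpace →ₗ[ℂ] PiLp 2 (fun e : T.Edge => L2 (T.len e)) where
  toFun y := WithLp.toLp 2 fun e => y.deriv e
  map_add' _ _ := rfl
  map_smul' _ _ := rfl

/-- If the values at the root and the integrals over the edges of the derivatives converge along a
sequence in `V`, then so do the values at all vertices. -/
lemma exists_tendsto_val (u : ℕ → T.VSpace)
    (hu : ∀ e, ∃ c, Tendsto (fun n => ∫ s in (0 : ℝ)..T.len e, (u n).deriv e s) atTop (𝓝 c))
    (k : V) : ∃ c, Tendsto (fun n => (u n).val k) atTop (𝓝 c) := by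
  have hw : ∀ a b : V, T.graph.Walk a b →
      (∃ c, Tendsto (fun n => (u n).val a) atTop (𝓝 c)) →
      ∃ c, Tendsto (fun n => (u n).val b) atTop (𝓝 c) := by
    intro a b w
    induction w with
    | nil => exact id
    | @cons a b _ hab _ ih =>
      rintro ⟨c, hc⟩
      refine ih ?_
      obtain ⟨d, hd⟩ := hu ⟨s(a, b), hab⟩
      set e : T.Edge := ⟨s(a, b), hab⟩ with he
      have hne : T.init e ≠ T.term e := by
        have : T.graph.Adj (T.init e) (T.term e) := by
          rw [← SimpleGraph.mem_edgeSet, T.ends e]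
          exact e.2
        exact this.ne
      have hi : T.init e ∈ (e : Sym2 V) := by rw [← T.ends e]; exact Sym2.mem_mk_left _ _
      have ht : T.term e ∈ (e : Sym2 V) := by rw [← T.ends e]; exact Sym2.mem_mk_right _ _
      have key : ∀ n, (u n).val (T.term e)
          = (u n).val (T.init e) + ∫ s in (0 : ℝ)..T.len e, (u n).deriv e s := by
        intro n
        rw [← (u n).fn_coord (e := e) ht, ← (u n).fn_coord (e := e) hi]
        simp only [coord, if_true, if_neg hne.symm]
        exact (u n).fn_eq e ⟨(T.len_pos e).le, le_rfl⟩
      have hends : (T.init e = a ∧ T.term e = b) ∨ (T.init e = b ∧ T.term e = a) := by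
        have := T.ends e
        simpa [he] using this
      rcases hends with ⟨h1, h2⟩ | ⟨h1, h2⟩
      · rw [h1, h2] at key
        exact ⟨c + d, (hc.add hd).congr fun n => (key n).symm⟩
      · rw [h1, h2] at key
        exact ⟨c - d, (hc.sub hd).congr fun n => by rw [key n]; ring⟩
  obtain ⟨w⟩ := T.isTree.1.preconnected T.root k
  exact hw _ _ w ⟨0, by simp [val_root]⟩

lemma fn_zero_eq_val (y : T.VSpace) (e : T.Edge) : y.fn e 0 = y.val (T.init e) := by
  have hne : T.init e ≠ T.term e := by
    have : T.graph.Adj (T.init e) (T.term e) := by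
      rw [← SimpleGraph.mem_edgeSet, T.ends e]
      exact e.2
    exact this.ne
  have hi : T.init e ∈ (e : Sym2 V) := by rw [← T.ends e]; exact Sym2.mem_mk_left _ _
  rw [← y.fn_coord (e := e) hi]
  simp only [coord, if_neg hne.symm]

lemma eq_zero_of_deriv {y : T.VSpace} (h : ∀ e, y.deriv e = 0) : y = 0 := by
  have hval : ∀ k, y.val k = 0 := by
    intro k
    obtain ⟨c, hc⟩ := exists_tendsto_val (fun n : ℕ => (n : ℂ) • y) (fun e => ⟨0, by
      have : ∀ n : ℕ, ((n : ℂ) • y).deriv e = 0 := fun n =>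
        (congrArg ((n : ℂ) • ·) (h e)).trans (smul_zero _)
      simp only [this, integral_zero_L2 ⟨(T.len_pos e).le, le_refl (T.len e)⟩]
      exact tendsto_const_nhds⟩) k
    simp only [val_smul] at hc
    have h1 := hc.mul (tendsto_inv_atTop_nhds_zero_nat (𝕜 := ℂ))
    rw [mul_zero] at h1
    refine tendsto_nhds_unique ?_ h1
    refine tendsto_const_nhds.congr' ?_
    filter_upwards [eventually_ne_atTop 0] with n hn
    have : (n : ℂ) ≠ 0 := Nat.cast_ne_zero.2 hn
    field_simp
  refine ext_fn (fun e => funext fun x => ?_) h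
  by_cases hx : x ∈ Icc 0 (T.len e)
  · rw [y.fn_eq e hx, h e, integral_zero_L2 hx, fn_zero_eq_val, hval, add_zero]
    rfl
  · rw [y.fn_outside e hx]
    rfl

lemma derivₗ_injective [Finite V] : Function.Injective (derivₗ (T := T)) := by
  rw [injective_iff_map_eq_zero]
  intro y hy
  exact eq_zero_of_deriv fun e => congrFun (congrArg WithLp.ofLp hy) e

instance [Finite V] : NormedAddCommGroup T.VSpace :=
  NormedAddCommGroup.induced T.VSpace _ derivₗ derivₗ_injective

/-- `V` carries the inner product `∑ ⟨dy^e/dx, dz^e/dx⟩`. -/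
instance [Finite V] : InnerProductSpace ℂ T.VSpace where
  inner y z := ∑ e, inner ℂ (y.deriv e) (z.deriv e)
  norm_smul_le c y := by
    change ‖derivₗ (c • y)‖ ≤ ‖c‖ * ‖derivₗ y‖
    rw [map_smul]
    exact norm_smul_le c _
  norm_sq_eq_re_inner y := norm_sq_eq_re_inner (𝕜 := ℂ) (derivₗ y)
  conj_inner_symm y z := inner_conj_symm (𝕜 := ℂ) (derivₗ y) (derivₗ z)
  add_left x y z := inner_add_left (𝕜 := ℂ) (derivₗ x) (derivₗ y) (derivₗ z)
  smul_left y z c := inner_smul_left (𝕜 := ℂ) (derivₗ y) (derivₗ z) c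

/-- `derivₗ` is an isometry. -/
lemma isometry_derivₗ [Finite V] : Isometry (derivₗ (T := T)) := by
  refine AddMonoidHomClass.isometry_of_norm _ fun y => rfl

instance [Finite V] : CompleteSpace T.VSpace := by
  refine Metric.complete_of_cauchySeq_tendsto fun u hu => ?_
  obtain ⟨w, hw⟩ := cauchySeq_tendsto_of_complete
    ((isometry_derivₗ (T := T)).uniformContinuous.comp_cauchySeq hu)
  have hwe : ∀ e, Tendsto (fun n => (u n).deriv e) atTop (𝓝 (w e)) := fun e =>
    ((PiLp.continuous_apply 2 _ e).tendsto w).comp hw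
  have hint : ∀ e, ∀ x ∈ Icc 0 (T.len e),
      Tendsto (fun n => ∫ s in (0 : ℝ)..x, (u n).deriv e s) atTop
        (𝓝 (∫ s in (0 : ℝ)..x, w e s)) := fun e x hx =>
    ((continuous_integral_L2 hx).tendsto (w e)).comp (hwe e)
  choose c hc using exists_tendsto_val u fun e => ⟨_, hint e _ ⟨(T.len_pos e).le, le_rfl⟩⟩
  classical
  let f : T.Edge → ℝ → ℂ := fun e x =>
    if x ∈ Icc 0 (T.len e) then c (T.init e) + ∫ s in (0 : ℝ)..x, w e s else 0
  have hf : ∀ e x, Tendsto (fun n => (u n).fn e x) atTop (𝓝 (f e x)) := by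
    intro e x
    by_cases hx : x ∈ Icc 0 (T.len e)
    · simp only [f, if_pos hx]
      refine ((hc (T.init e)).add (hint e x hx)).congr fun n => ?_
      rw [(u n).fn_eq e hx, fn_zero_eq_val]
    · simp only [f, if_neg hx, (u _).fn_outside e hx]
      exact tendsto_const_nhds
  let y₁ : ∀ e : T.Edge, H1 (T.len e) := fun e => ⟨(f e, w e), by
    refine ⟨fun x hx => ?_, fun x hx => if_neg hx⟩
    have h0 : (0 : ℝ) ∈ Icc 0 (T.len e) := ⟨le_rfl, (T.len_pos e).le⟩
    simp only [f, if_pos hx, if_pos h0]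
    simp⟩
  let y : T.VSpace := ⟨y₁, by
    refine ⟨fun e he => ?_, fun k hk e he e' he' => ?_⟩
    · refine tendsto_nhds_unique (hf e _) ?_
      simp only [fun n => (u n).fn_coord he, val_root]
      exact tendsto_const_nhds
    · refine tendsto_nhds_unique (hf e _) ?_
      refine (hf e' (T.coord e' k)).congr fun n => ?_
      rw [(u n).fn_coord he, (u n).fn_coord he']⟩
  refine ⟨y, ?_⟩
  have hy : derivₗ y = w := rfl
  rw [(Isometry.isUniformInducing isometry_derivₗ).isInducing.tendsto_nhds_iff, hy]
  exact hw

end VSpace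

/-- The state space `H = V × ∏ L²(0, len e) × (∏ ℂ)²`, with the Hilbert norm whose square is
`∑ (‖y_e'‖² + ‖v_e‖²) + ∑ (|p_k|² + |q_k|²)`. -/
abbrev State [Finite V] : Type _ :=
  WithLp 2 (T.VSpace × WithLp 2 (PiLp 2 (fun e : T.Edge => L2 (T.len e)) ×
    WithLp 2 (EuclideanSpace ℂ T.Mass × EuclideanSpace ℂ T.Mass)))

namespace State

variable {T} [Finite V]

/-- The first component `y`. -/
def y (z : T.State) : T.VSpace := z.fst

/-- The second component `v` (the velocity `y_t` of the fluid potential). -/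
def v (z : T.State) (e : T.Edge) : L2 (T.len e) := z.snd.fst e

/-- The third component `p` (the displacements `s` of the point masses). -/
def p (z : T.State) (k : T.Mass) : ℂ := z.snd.snd.fst k

/-- The fourth component `q` (the velocities `s'` of the point masses). -/
def q (z : T.State) (k : T.Mass) : ℂ := z.snd.snd.snd k

/-- The energy of a state. -/
def energy (z : T.State) : ℝ :=
  (1 / 2) * ∑ e, (∫ x in (0 : ℝ)..T.len e, (‖z.v e x‖ ^ 2 + ‖z.y.deriv e x‖ ^ 2))
    + (1 / 2) * ∑ k, (‖z.q k‖ ^ 2 + ‖z.p k‖ ^ 2)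

end State

section Generator

variable [Finite V]

/-- The relation `𝒜 z = Z`. For `z = (y, v, p, q)` it says that `y` is in `∏ H²`, i.e. the class
`dy/dx` has a representative `dy` in `∏ H¹`, whose derivative `d²y/dx²` is the second component of
`Z`; that `v` is (the class of) an element of `V`, which is the first component of `Z`; that the
transmission conditions at the interior vertices and the feedback conditions at the leaves hold;
and that the last two components of `Z` are `q` and `-p - v_M`. -/
structure IsImage (z Z : T.State) (dy : ∀ e : T.Edge, H1 (T.len e)) : Prop where
  deriv_y : ∀ e, z.y.deriv e =ᵐ[volume.restrict (Ioo 0 (T.len e))] H1.fn (dy e)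
  v_eq : ∀ e, z.v e =ᵐ[volume.restrict (Ioo 0 (T.len e))] Z.y.fn e
  transmission : ∀ k : T.Mass,
    ∑ e, T.incidence k e * H1.fn (dy e) (T.coord e k) = z.q k
  feedback : ∀ k : T.Leaf,
    T.incidence k (T.edgeAt k) * H1.fn (dy (T.edgeAt k)) (T.coord (T.edgeAt k) k) = - Z.y.val k
  snd_eq : ∀ e, Z.v e = H1.deriv (dy e)
  p_eq : ∀ k, Z.p k = z.q k
  q_eq : ∀ k, Z.q k = - z.p k - Z.y.val k

/-- The graph of the operator `𝒜`. -/
def generatorGraph : Submodule ℂ (T.State × T.State) where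
  carrier := {P | ∃ dy, T.IsImage P.1 P.2 dy}
  zero_mem' := by
    refine ⟨0, fun e => Lp.coeFn_zero _ _ _, fun e => Lp.coeFn_zero _ _ _, fun k => ?_, fun k => ?_,
      fun e => rfl, fun k => rfl, fun k => ?_⟩
    · exact Finset.sum_eq_zero fun e _ => mul_zero _
    · exact (mul_zero _).trans neg_zero.symm
    · change (0 : ℂ) = - 0 - 0
      simp
  add_mem' := by
    rintro P P' ⟨d, h⟩ ⟨d', h'⟩
    refine ⟨d + d', fun e => ?_, fun e => ?_, fun k => ?_, fun k => ?_, fun e => ?_, fun k => ?_,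
      fun k => ?_⟩
    · exact (Lp.coeFn_add _ _).trans ((h.deriv_y e).add (h'.deriv_y e))
    · exact (Lp.coeFn_add _ _).trans ((h.v_eq e).add (h'.v_eq e))
    · refine Eq.trans ?_ (congrArg₂ (· + ·) (h.transmission k) (h'.transmission k))
      rw [← Finset.sum_add_distrib]
      exact Finset.sum_congr rfl fun e _ => mul_add _ _ _
    · refine (mul_add _ _ _).trans ?_
      refine (congrArg₂ (· + ·) (h.feedback k) (h'.feedback k)).trans ?_
      exact (neg_add _ _).symm
    · exact congrArg₂ (· + ·) (h.snd_eq e) (h'.snd_eq e)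
    · exact congrArg₂ (· + ·) (h.p_eq k) (h'.p_eq k)
    · refine (congrArg₂ (· + ·) (h.q_eq k) (h'.q_eq k)).trans ?_
      change _ = - (P.1.p k + P'.1.p k) - (P.2.y.val k + P'.2.y.val k)
      ring
  smul_mem' := by
    rintro a P ⟨d, h⟩
    refine ⟨a • d, fun e => ?_, fun e => ?_, fun k => ?_, fun k => ?_, fun e => ?_, fun k => ?_,
      fun k => ?_⟩
    · exact (Lp.coeFn_smul _ _).trans ((h.deriv_y e).const_smul a)
    · exact (Lp.coeFn_smul _ _).trans ((h.v_eq e).const_smul a)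
    · refine Eq.trans ?_ (congrArg (a * ·) (h.transmission k))
      refine Eq.trans ?_ (Finset.mul_sum _ _ _).symm
      exact Finset.sum_congr rfl fun e _ => mul_left_comm _ _ _
    · refine (mul_left_comm _ _ _).trans ?_
      refine (congrArg (a * ·) (h.feedback k)).trans ?_
      exact mul_neg _ _
    · exact congrArg (a • ·) (h.snd_eq e)
    · exact congrArg (a * ·) (h.p_eq k)
    · refine (congrArg (a * ·) (h.q_eq k)).trans ?_
      change _ = - (a * P.1.p k) - a * P.2.y.val k
      ring

lemma generatorGraph_single_valued (P : T.State × T.State) (hP : P ∈ T.generatorGraph)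
    (h : P.1 = 0) : P.2 = 0 := by
  obtain ⟨z, Z⟩ := P
  obtain ⟨d, hd⟩ := hP
  obtain rfl : z = 0 := h
  have hdy : ∀ e, d e = 0 := fun e =>
    H1.eq_zero_of_ae (T.len_pos e) _ ((hd.deriv_y e).symm.trans (Lp.coeFn_zero _ _ _))
  have hy : Z.y = 0 := by
    refine Subtype.ext (funext fun e => ?_)
    exact H1.eq_zero_of_ae (T.len_pos e) _ ((hd.v_eq e).symm.trans (Lp.coeFn_zero _ _ _))
  have hv : Z.snd.fst = 0 := by
    ext1 e
    exact (hd.snd_eq e).trans (by rw [hdy e]; rfl)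
  have hp : Z.snd.snd.fst = 0 := by
    ext1 k
    exact hd.p_eq k
  have hq : Z.snd.snd.snd = 0 := by
    ext1 k
    refine (hd.q_eq k).trans ?_
    rw [hy]
    change - (0 : ℂ) - 0 = 0
    simp
  refine WithLp.ofLp_injective 2 (Prod.ext hy ?_)
  refine WithLp.ofLp_injective 2 (Prod.ext hv ?_)
  exact WithLp.ofLp_injective 2 (Prod.ext hp hq)

/-- The operator `𝒜` on `H`, with domain `D(𝒜)`. -/
def generator : T.State →ₗ.[ℂ] T.State := T.generatorGraph.toLinearPMap

lemma mem_generator_graph (z Z : T.State) :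
    (z, Z) ∈ T.generator.graph ↔ ∃ dy, T.IsImage z Z dy := by
  rw [generator, Submodule.toLinearPMap_graph_eq _ T.generatorGraph_single_valued]
  rfl

lemma mem_generator_domain (z : T.State) :
    z ∈ T.generator.domain ↔ ∃ Z dy, T.IsImage z Z dy := by
  rw [LinearPMap.mem_domain_iff]
  exact exists_congr fun Z => T.mem_generator_graph z Z

/-- `z = (y, y', s, s')` is a solution in `C([0, ∞); H)` of the initial value problem with data
`z₀ ∈ H`, in the integrated (mild) sense: the equation `z' = 𝒜 z`, `z(0) = z₀`, integrated in time,
i.e. `∫₀ᵗ z ∈ D(𝒜)` and `z(t) = z₀ + 𝒜 ∫₀ᵗ z` for all `t ≥ 0`. -/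
def IsSolution (z₀ : T.State) (z : ℝ → T.State) : Prop :=
  ContinuousOn z (Ici 0) ∧
    ∀ t, 0 ≤ t → ∃ h : (∫ s in (0 : ℝ)..t, z s) ∈ T.generator.domain,
      z t = z₀ + T.generator ⟨∫ s in (0 : ℝ)..t, z s, h⟩

/-- `z` is in `C([0, ∞); D(𝒜)) ∩ C¹([0, ∞); H)`, with `D(𝒜)` carrying the graph norm,
and satisfies `z' = 𝒜 z`, `z(0) = z₀`; here `w = 𝒜 z = z'`. -/
structure IsClassicalSolution (z₀ : T.State) (z w : ℝ → T.State) : Prop where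
  initial : z 0 = z₀
  continuousOn : ContinuousOn z (Ici 0)
  continuousOn_image : ContinuousOn w (Ici 0)
  mem_domain : ∀ t, 0 ≤ t → ∃ h : z t ∈ T.generator.domain, T.generator ⟨z t, h⟩ = w t
  hasDeriv : ∀ t, 0 ≤ t → HasDerivWithinAt z (w t) (Ici 0) t

/-- `S` is a `C₀`-semigroup of contractions on `H`. -/
structure IsContractionSemigroup (S : ℝ → T.State →L[ℂ] T.State) : Prop where
  zero : S 0 = 1
  add : ∀ s t, 0 ≤ s → 0 ≤ t → S (s + t) = S s * S t
  continuousOn : ∀ z, ContinuousOn (fun t => S t z) (Ici 0)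
  norm_le : ∀ t, 0 ≤ t → ‖S t‖ ≤ 1

/-- `𝒜` is the infinitesimal generator of `S`: `z ∈ D(𝒜)` and `𝒜 z = Z` if and only if
`(S(t) z - z) / t → Z` as `t → 0+`. -/
def Generates (S : ℝ → T.State →L[ℂ] T.State) : Prop :=
  ∀ z Z : T.State, (∃ h : z ∈ T.generator.domain, T.generator ⟨z, h⟩ = Z) ↔
    Tendsto (fun t : ℝ => ((t⁻¹ : ℝ) : ℂ) • (S t z - z)) (𝓝[>] 0) (𝓝 Z)

end Generator

end RootedMetricTree

end

/-! The equation is an abstract Cauchy problem for an m-dissipative operator, so existence,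
uniqueness and the contraction property come from the Lumer–Phillips theorem, which is proved here
from scratch in a complex Hilbert space. The operator is handled through its graph `G`.
Dissipativity and the range condition give resolvents with `l‖R z‖ ≤ ‖z‖`. The bounded Yosida
approximations `A_n = (n + 1)(J_n - 1)`, with `J_n = (n + 1)(n + 1 - A)⁻¹`, commute and are
dissipative, so their exponentials are contractions. These converge uniformly on bounded time
intervals, first for data in the domain and then, by density, for all data. The graph is closed,
which gives the integrated equation in the limit (`integral_semigroup_mem`). Uniqueness holds
because the primitive of a mild solution with zero data is a curve along which the norm cannot grow.

For the tree, two facts are needed. Green's formula (`VSpace.sum_inner_deriv_add`) turns the edge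
terms of `Re ⟨𝒜z, z⟩` into vertex terms: those at the masses cancel and those at the leaves leave
`-∑ |v(a_k)|²` (`IsImage.re_inner`). For the range, `v`, `p` and `q` are eliminated from `l z - 𝒜z =
w`. What remains is a coercive variational problem for `y` in `V` (`exists_weak`), whose solution is
regular and satisfies the natural vertex conditions (`exists_strong_of_weak`).

The energy identity is the integrated dissipation law when the data lie in the domain. It also
bounds the leaf traces of the velocity in `L²(0, ∞)` by the norm of the initial state. For arbitrary
data, approximated by `J_n z₀`, the traces therefore form a Cauchy sequence. Since point values are
continuous on `V`, the limit is the derivative of `t ↦ y(a_k, t)`, and the identity passes to the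
limit (`exists_trace`). -/

noncomputable section

/-! ### m-dissipative operators and their contraction semigroups -/

section Abstract

variable {E : Type*} [NormedAddCommGroup E] [InnerProductSpace ℂ E]

/-- The graph of an m-dissipative operator on a Hilbert space. -/
structure IsMDissipative (G : Submodule ℂ (E × E)) : Prop where
  single_valued : ∀ y, ((0 : E), y) ∈ G → y = 0
  dissipative : ∀ x y, (x, y) ∈ G → (inner ℂ y x).re ≤ 0
  range : ∀ l : ℝ, 0 < l → ∀ z, ∃ x, (x, (l : ℂ) • x - z) ∈ G

lemma re_inner_self_eq (x : E) : (inner ℂ x x).re = ‖x‖ ^ 2 := by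
  have := inner_self_eq_norm_sq (𝕜 := ℂ) x
  simpa using this

/-- Along a curve the derivative of `‖u‖²` is `2 Re ⟨u', u⟩`. -/
lemma hasDerivWithinAt_norm_sq {u : ℝ → E} {u' : E} {s : Set ℝ} {t : ℝ}
    (hu : HasDerivWithinAt u u' s t) :
    HasDerivWithinAt (fun t => ‖u t‖ ^ 2) (2 * (inner ℂ u' (u t)).re) s t := by
  have h := HasDerivWithinAt.inner ℂ hu hu
  have h2 := (Complex.reCLM.hasFDerivAt (x := inner ℂ (u t) (u t))).comp_hasDerivWithinAt t h
  have h3 : (Complex.reCLM (inner ℂ (u t) u' + inner ℂ u' (u t))) = 2 * (inner ℂ u' (u t)).re := by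
    have : (inner ℂ (u t) u').re = (inner ℂ u' (u t)).re := by
      rw [← inner_conj_symm, Complex.conj_re]
    simp only [Complex.reCLM_apply, Complex.add_re, this]
    ring
  rw [h3] at h2
  exact h2.congr_of_eventuallyEq (Eventually.of_forall fun x => (re_inner_self_eq (u x)).symm)
    (re_inner_self_eq (u t)).symm

/-- The norm is nonincreasing along a curve with `Re ⟨u', u⟩ ≤ 0`. -/
lemma norm_le_of_re_inner_nonpos {u u' : ℝ → E} (hc : ContinuousOn u (Ici 0))
    (hu : ∀ t, 0 ≤ t → HasDerivWithinAt u (u' t) (Ici t) t)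
    (h : ∀ t, 0 ≤ t → (inner ℂ (u' t) (u t)).re ≤ 0) {t : ℝ} (ht : 0 ≤ t) : ‖u t‖ ≤ ‖u 0‖ := by
  have key := image_le_of_deriv_right_le_deriv_boundary (f := fun t => ‖u t‖ ^ 2) (a := 0) (b := t)
    (((hc.mono Icc_subset_Ici_self).norm).pow 2)
    (fun x hx => hasDerivWithinAt_norm_sq (hu x hx.1)) (B := fun _ => ‖u 0‖ ^ 2) (B' := fun _ => 0)
    le_rfl continuousOn_const (fun x _ => hasDerivWithinAt_const _ _ _)
    (fun x hx => by have := h x hx.1; linarith) ⟨ht, le_rfl⟩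
  exact (sq_le_sq₀ (norm_nonneg _) (norm_nonneg _)).1 key

/-- The fundamental theorem of calculus on the half-line. -/
lemma hasDerivWithinAt_integral {F : Type*} [NormedAddCommGroup F] [NormedSpace ℝ F]
    [CompleteSpace F] {f : ℝ → F} (hf : ContinuousOn f (Ici 0)) {t : ℝ} (ht : 0 ≤ t) :
    HasDerivWithinAt (fun t => ∫ s in (0 : ℝ)..t, f s) (f t) (Ici 0) t := by
  -- Freezing `f` at `f 0` for negative times gives a function continuous on the whole line, to
  -- which the two-sided theorem applies.
  have hg : Continuous fun s => f (max s 0) :=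
    hf.comp_continuous (continuous_id.max continuous_const) fun s => mem_Ici.2 (le_max_right _ _)
  have h1 := (hg.integral_hasStrictDerivAt 0 t).hasDerivAt.hasDerivWithinAt (s := Ici 0)
  rw [max_eq_left ht] at h1
  refine h1.congr_of_mem (fun x hx => ?_) ht
  refine intervalIntegral.integral_congr fun s hs => ?_
  rw [uIcc_of_le hx] at hs
  simp only [max_eq_left hs.1]

/-! ### Resolvents and Yosida approximations -/

namespace IsMDissipative

variable {G : Submodule ℂ (E × E)}

/-- Dissipativity gives `l‖x‖² ≤ Re ⟨l x - y, x⟩`, and Cauchy–Schwarz bounds the right side by `‖l x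
- y‖ ‖x‖`. -/
lemma mul_norm_le (hG : IsMDissipative G) {x y : E} (h : (x, y) ∈ G) (l : ℝ) :
    l * ‖x‖ ≤ ‖(l : ℂ) • x - y‖ := by
  rcases eq_or_ne x 0 with rfl | hx
  · simp
  have h1 : l * ‖x‖ ^ 2 ≤ (inner ℂ ((l : ℂ) • x - y) x).re := by
    rw [inner_sub_left, inner_smul_left, Complex.sub_re, Complex.conj_ofReal, Complex.re_ofReal_mul,
      re_inner_self_eq]
    linarith [hG.dissipative x y h]
  have h2 : (inner ℂ ((l : ℂ) • x - y) x).re ≤ ‖(l : ℂ) • x - y‖ * ‖x‖ :=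
    (Complex.re_le_norm _).trans (norm_inner_le_norm _ _)
  have h3 : 0 < ‖x‖ := norm_pos_iff.2 hx
  nlinarith

/-- The range condition provides a solution of `l x - A x = z`. The estimate `mul_norm_le`, applied
to a difference of two solutions, makes it unique; uniqueness gives linearity, and the same estimate
gives the bound. -/
lemma exists_resolvent (hG : IsMDissipative G) {l : ℝ} (hl : 0 < l) :
    ∃ R : E →L[ℂ] E, (∀ z, l * ‖R z‖ ≤ ‖z‖) ∧ (∀ z, (R z, (l : ℂ) • R z - z) ∈ G) ∧
      ∀ x y, (x, y) ∈ G → R ((l : ℂ) • x - y) = x := by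
  choose R hR using hG.range l hl
  have huniq : ∀ x y, (x, y) ∈ G → R ((l : ℂ) • x - y) = x := by
    intro x y h
    have h1 := hG.mul_norm_le (G.sub_mem (hR ((l : ℂ) • x - y)) h) l
    have h2 : (l : ℂ) • (R ((l : ℂ) • x - y) - x)
        - ((l : ℂ) • R ((l : ℂ) • x - y) - ((l : ℂ) • x - y) - y) = 0 := by
      rw [smul_sub]; abel
    simp only [h2, norm_zero] at h1
    have h3 : ‖R ((l : ℂ) • x - y) - x‖ ≤ 0 := by
      by_contra h4
      push Not at h4
      linarith [mul_pos hl h4]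
    exact sub_eq_zero.1 (norm_le_zero_iff.1 h3)
  have hbd : ∀ z, l * ‖R z‖ ≤ ‖z‖ := by
    intro z
    have h1 := hG.mul_norm_le (hR z) l
    rwa [sub_sub_cancel] at h1
  let R' : E →ₗ[ℂ] E :=
    { toFun := R
      map_add' := fun z w => by
        have h1 : R ((l : ℂ) • (R z + R w) - (((l : ℂ) • R z - z) + ((l : ℂ) • R w - w)))
            = R z + R w := huniq _ _ (G.add_mem (hR z) (hR w))
        rw [← h1]
        congr 1
        module
      map_smul' := fun c z => by
        have h1 := huniq _ _ (G.smul_mem c (hR z))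
        rw [RingHom.id_apply, ← h1]
        congr 1
        rw [smul_sub, smul_comm c (l : ℂ), sub_sub_cancel] }
  refine ⟨R'.mkContinuous l⁻¹ fun z => ?_, hbd, hR, huniq⟩
  rw [inv_mul_eq_div, le_div_iff₀ hl, mul_comm]
  exact hbd z

/-- The resolvent `(n + 1 - A)⁻¹`. -/
def resolvent (hG : IsMDissipative G) (n : ℕ) : E →L[ℂ] E :=
  (hG.exists_resolvent n.cast_add_one_pos).choose

variable (hG : IsMDissipative G)
include hG

lemma norm_resolvent_le (n : ℕ) (z : E) : ((n : ℝ) + 1) * ‖hG.resolvent n z‖ ≤ ‖z‖ :=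
  (hG.exists_resolvent n.cast_add_one_pos).choose_spec.1 z

lemma resolvent_mem (n : ℕ) (z : E) :
    (hG.resolvent n z, (((n : ℝ) + 1 : ℝ) : ℂ) • hG.resolvent n z - z) ∈ G :=
  (hG.exists_resolvent n.cast_add_one_pos).choose_spec.2.1 z

lemma resolvent_apply (n : ℕ) {x y : E} (h : (x, y) ∈ G) :
    hG.resolvent n ((((n : ℝ) + 1 : ℝ) : ℂ) • x - y) = x :=
  (hG.exists_resolvent n.cast_add_one_pos).choose_spec.2.2 x y h

/-- `J = (n + 1) (n + 1 - A)⁻¹`. -/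
def regularization (n : ℕ) : E →L[ℂ] E := (((n : ℝ) + 1 : ℝ) : ℂ) • hG.resolvent n

/-- The Yosida approximation `A J = (n + 1) (J - 1)` of `A`. -/
def yosida (n : ℕ) : E →L[ℂ] E := (((n : ℝ) + 1 : ℝ) : ℂ) • (hG.regularization n - 1)

lemma norm_regularization_le (n : ℕ) (z : E) : ‖hG.regularization n z‖ ≤ ‖z‖ := by
  have h : (0 : ℝ) ≤ (n : ℝ) + 1 := n.cast_add_one_pos.le
  rw [regularization, smul_apply, norm_smul, Complex.norm_real,
    Real.norm_of_nonneg h]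
  exact hG.norm_resolvent_le n z

/-- This is the source of approximations inside the domain: `J_n z` lies there for every `z`, with
image `A_n z`. -/
lemma regularization_yosida_mem (n : ℕ) (z : E) :
    (hG.regularization n z, hG.yosida n z) ∈ G :=
  G.smul_mem (((n : ℝ) + 1 : ℝ) : ℂ) (hG.resolvent_mem n z)

lemma regularization_sub (n : ℕ) {x y : E} (h : (x, y) ∈ G) :
    hG.regularization n x - x = hG.resolvent n y := by
  have h1 := hG.resolvent_apply n h
  rw [map_sub, map_smul] at h1
  rw [sub_eq_iff_eq_add'] at h1
  rw [regularization, smul_apply, h1, add_sub_cancel_right]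

/-- On the domain `A_n x = J_n A x`, so the convergence of `A_n x` to `A x` reduces to that of `J_n`
to the identity. -/
lemma yosida_apply (n : ℕ) {x y : E} (h : (x, y) ∈ G) :
    hG.yosida n x = hG.regularization n y := by
  rw [yosida, smul_apply, sub_apply,
    one_apply_eq_self, hG.regularization_sub n h]
  rfl

/-- The resolvent identity `R_m + (m - n) R_m R_n = R_n`, written also with `m` and `n` exchanged,
gives two expressions for the products; for `m ≠ n` the factor `m - n` can be cancelled. -/
lemma commute_resolvent (m n : ℕ) : Commute (hG.resolvent m) (hG.resolvent n) := by
  rcases eq_or_ne m n with rfl | hmn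
  · exact Commute.refl _
  have key : ∀ (m n : ℕ) (z : E), hG.resolvent m z + (((m : ℝ) : ℂ) - ((n : ℝ) : ℂ)) •
      hG.resolvent m (hG.resolvent n z) = hG.resolvent n z := by
    intro m n z
    have h1 := hG.resolvent_apply m (hG.resolvent_mem n z)
    rw [← map_smul, ← map_add]
    refine Eq.trans ?_ h1
    congr 1
    push_cast
    module
  refine ContinuousLinearMap.ext fun z => ?_
  change hG.resolvent m (hG.resolvent n z) = hG.resolvent n (hG.resolvent m z)
  have h1 := key m n z
  have h2 := key n m z
  have hne : ((m : ℝ) : ℂ) - ((n : ℝ) : ℂ) ≠ 0 := by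
    rw [sub_ne_zero]
    exact_mod_cast hmn
  refine smul_right_injective E hne ?_
  change (((m : ℝ) : ℂ) - ((n : ℝ) : ℂ)) • _ = (((m : ℝ) : ℂ) - ((n : ℝ) : ℂ)) • _
  rw [← sub_eq_zero]
  have h3 : (((m : ℝ) : ℂ) - ((n : ℝ) : ℂ)) • hG.resolvent m (hG.resolvent n z)
      = hG.resolvent n z - hG.resolvent m z := eq_sub_of_add_eq' h1
  have h4 : (((n : ℝ) : ℂ) - ((m : ℝ) : ℂ)) • hG.resolvent n (hG.resolvent m z)
      = hG.resolvent m z - hG.resolvent n z := eq_sub_of_add_eq' h2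
  rw [h3, ← neg_sub ((n : ℝ) : ℂ), neg_smul, h4]
  module

lemma commute_yosida (m n : ℕ) : Commute (hG.yosida m) (hG.yosida n) := by
  have h := hG.commute_resolvent m n
  unfold yosida regularization
  refine Commute.smul_left (Commute.smul_right ?_ _) _
  refine Commute.sub_left (Commute.sub_right ?_ (Commute.one_right _)) (Commute.one_left _)
  exact Commute.smul_left (Commute.smul_right h _) _

/-- `J_n` is a contraction, hence `Re ⟨J_n z, z⟩ ≤ ‖z‖²`. -/
lemma yosida_dissipative (n : ℕ) (z : E) : (inner ℂ (hG.yosida n z) z).re ≤ 0 := by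
  have h : (0 : ℝ) ≤ (n : ℝ) + 1 := n.cast_add_one_pos.le
  rw [yosida, smul_apply, inner_smul_left, Complex.conj_ofReal,
    Complex.re_ofReal_mul, sub_apply, inner_sub_left, Complex.sub_re]
  refine mul_nonpos_of_nonneg_of_nonpos h ?_
  have h1 : (inner ℂ (hG.regularization n z) z).re ≤ ‖z‖ * ‖z‖ :=
    ((Complex.re_le_norm _).trans (norm_inner_le_norm _ _)).trans
      (mul_le_mul_of_nonneg_right (hG.norm_regularization_le n z) (norm_nonneg _))
  rw [one_apply_eq_self, re_inner_self_eq]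
  linarith

/-- A pair `(x, y)` lies in the graph exactly when `R (x - y) = x` for the bounded resolvent at `l =
1`, which is a closed condition. -/
lemma isClosed_graph : IsClosed (G : Set (E × E)) := by
  have : (G : Set (E × E)) = {p | hG.resolvent 0 ((((0 : ℕ) : ℝ) + 1 : ℝ) • p.1 - p.2) = p.1} := by
    ext p
    refine ⟨fun h => ?_, fun h => ?_⟩
    · exact hG.resolvent_apply 0 (x := p.1) (y := p.2) h
    · have h1 := hG.resolvent_mem 0 ((((0 : ℕ) : ℝ) + 1 : ℝ) • p.1 - p.2)
      rw [mem_ofPred_eq] at h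
      rw [h] at h1
      have h2 : (((((0 : ℕ) : ℝ) + 1 : ℝ)) : ℂ) • p.1
          - ((((0 : ℕ) : ℝ) + 1 : ℝ) • p.1 - p.2) = p.2 :=
        sub_sub_cancel _ _
      rw [h2] at h1
      exact h1
  rw [this]
  exact isClosed_eq (by fun_prop) continuous_fst

variable [CompleteSpace E]

/-- Let `z` be orthogonal to the domain and solve `x - A x = z`. Then `⟨z, x⟩ = 0`, so `Re ⟨A x, x⟩
= ‖x‖² ≤ 0`. Thus `x = 0`, and `z = 0` because the graph is single valued. -/
lemma dense_domain : Dense {x : E | ∃ y, (x, y) ∈ G} := by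
  have h1 : {x : E | ∃ y, (x, y) ∈ G} = (G.map (LinearMap.fst ℂ E E) : Set E) := by
    ext x
    simp
  rw [h1, Submodule.dense_iff_topologicalClosure_eq_top, Submodule.topologicalClosure_eq_top_iff,
    Submodule.eq_bot_iff]
  intro z hz
  obtain ⟨x, hx⟩ := hG.range 1 one_pos z
  have h2 : inner ℂ x z = 0 :=
    hz x (Submodule.mem_map.2 ⟨_, hx, rfl⟩)
  have h3 := hG.dissipative _ _ hx
  have h4 : inner ℂ z x = 0 := by rw [← inner_conj_symm, h2, map_zero]
  rw [inner_sub_left, h4, Complex.ofReal_one, one_smul, sub_zero, re_inner_self_eq] at h3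
  have h5 : x = 0 :=
    norm_eq_zero.1 (pow_eq_zero_iff two_ne_zero |>.1 (le_antisymm h3 (sq_nonneg _)))
  rw [h5] at hx
  have h6 := hG.single_valued _ hx
  rw [smul_zero, zero_sub, neg_eq_zero] at h6
  exact h6

/-- On the domain `J_n x - x = R_n A x` has norm at most `‖A x‖ / (n + 1)`. Density and the bound
`‖J_n‖ ≤ 1` extend the convergence to all vectors. -/
lemma tendsto_regularization (z : E) :
    Tendsto (fun n => hG.regularization n z) atTop (𝓝 z) := by
  rw [Metric.tendsto_atTop]
  intro ε hε
  obtain ⟨x, ⟨y, hxy⟩, hx⟩ := hG.dense_domain.exists_dist_lt z (ε := ε / 3) (by positivity)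
  obtain ⟨N, hN⟩ := exists_nat_gt (‖y‖ / (ε / 3))
  refine ⟨N, fun n hn => ?_⟩
  have h1 : ‖hG.resolvent n y‖ < ε / 3 := by
    have h2 := hG.norm_resolvent_le n y
    have h3 : (0 : ℝ) < n + 1 := n.cast_add_one_pos
    rw [div_lt_iff₀ (by positivity)] at hN
    have h4 : (N : ℝ) ≤ n := by exact_mod_cast hn
    by_contra h5
    push Not at h5
    have h6 : ((n : ℝ) + 1) * (ε / 3) ≤ ‖y‖ :=
      (mul_le_mul_of_nonneg_left h5 h3.le).trans h2
    nlinarith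
  rw [← hG.regularization_sub n hxy] at h1
  have h2 := hG.norm_regularization_le n (z - x)
  rw [dist_eq_norm] at hx ⊢
  have h3 : hG.regularization n z - z
      = hG.regularization n (z - x) + (hG.regularization n x - x) - (z - x) := by
    rw [map_sub]; abel
  rw [h3]
  have h4 := norm_sub_le (hG.regularization n (z - x) + (hG.regularization n x - x)) (z - x)
  have h5 := norm_add_le (hG.regularization n (z - x)) (hG.regularization n x - x)
  linarith

/-! ### Convergence of the approximating exponentials -/

/-- The semigroup `exp (t A J)` of the Yosida approximation. -/
def yosidaExp (n : ℕ) (t : ℝ) : E →L[ℂ] E := NormedSpace.exp (t • hG.yosida n)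

lemma yosidaExp_zero (n : ℕ) : hG.yosidaExp n 0 = 1 := by
  rw [yosidaExp, zero_smul, NormedSpace.exp_zero]

lemma hasDerivAt_yosidaExp (n : ℕ) (t : ℝ) :
    HasDerivAt (hG.yosidaExp n) (hG.yosidaExp n t * hG.yosida n) t :=
  hasDerivAt_exp_smul_const _ _

lemma commute_yosidaExp_yosida (m n : ℕ) (t : ℝ) :
    Commute (hG.yosidaExp m t) (hG.yosida n) :=
  ((hG.commute_yosida m n).smul_left t).exp_left

lemma yosidaExp_add (n : ℕ) (s t : ℝ) :
    hG.yosidaExp n (s + t) = hG.yosidaExp n s * hG.yosidaExp n t := by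
  rw [yosidaExp, add_smul]
  have : NormedAlgebra ℚ (E →L[ℂ] E) := .restrictScalars ℚ ℂ _
  exact NormedSpace.exp_add_of_commute (((Commute.refl _).smul_left s).smul_right t)

lemma hasDerivAt_yosidaExp_apply (n : ℕ) (t : ℝ) (x : E) :
    HasDerivAt (fun t => hG.yosidaExp n t x) (hG.yosidaExp n t (hG.yosida n x)) t := by
  exact ((ContinuousLinearMap.apply ℂ E x).restrictScalars ℝ).hasFDerivAt.comp_hasDerivAt t
    (hG.hasDerivAt_yosidaExp n t)

lemma continuous_yosidaExp_apply (n : ℕ) (x : E) : Continuous fun t => hG.yosidaExp n t x :=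
  continuous_iff_continuousAt.2 fun t => (hG.hasDerivAt_yosidaExp_apply n t x).continuousAt

lemma norm_yosidaExp_le (n : ℕ) {t : ℝ} (ht : 0 ≤ t) (x : E) : ‖hG.yosidaExp n t x‖ ≤ ‖x‖ := by
  have h := norm_le_of_re_inner_nonpos (hG.continuous_yosidaExp_apply n x).continuousOn
    (fun t _ => (hG.hasDerivAt_yosidaExp_apply n t x).hasDerivWithinAt) (fun t _ => by
      have h1 : hG.yosidaExp n t (hG.yosida n x) = hG.yosida n (hG.yosidaExp n t x) :=
        DFunLike.congr_fun (hG.commute_yosidaExp_yosida n n t).eq x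
      rw [h1]
      exact hG.yosida_dissipative n _) ht
  simpa [yosidaExp_zero] using h

/-- The curve `s ↦ exp (s A_m) exp ((t - s) A_n) x` joins the two exponentials. By commutation its
derivative is two contractions applied to `A_m x - A_n x`. -/
lemma norm_yosidaExp_sub_le (m n : ℕ) {t : ℝ} (ht : 0 ≤ t) (x : E) :
    ‖hG.yosidaExp m t x - hG.yosidaExp n t x‖ ≤ t * ‖hG.yosida m x - hG.yosida n x‖ := by
  have hd : ∀ s ∈ Icc 0 t, HasDerivWithinAt
      (fun s => hG.yosidaExp m s (hG.yosidaExp n (t - s) x))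
      (hG.yosidaExp m s (hG.yosidaExp n (t - s) (hG.yosida m x - hG.yosida n x))) (Icc 0 t) s := by
    intro s _
    have h1 : HasDerivAt (fun s => hG.yosidaExp n (t - s) x)
        (-(hG.yosidaExp n (t - s) (hG.yosida n x))) s := by
      have := (hG.hasDerivAt_yosidaExp_apply n (t - s) x).scomp s ((hasDerivAt_id s).const_sub t)
      rwa [neg_one_smul] at this
    have h2 := ((ContinuousLinearMap.restrictScalarsL ℂ E E ℝ ℝ).hasFDerivAt.comp_hasDerivAt s
      (hG.hasDerivAt_yosidaExp m s)).clm_apply h1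
    refine (h2.congr_deriv ?_).hasDerivWithinAt
    have h3 : hG.yosida m (hG.yosidaExp n (t - s) x) = hG.yosidaExp n (t - s) (hG.yosida m x) :=
      (DFunLike.congr_fun (hG.commute_yosidaExp_yosida n m (t - s)).eq x).symm
    change hG.yosidaExp m s (hG.yosida m (hG.yosidaExp n (t - s) x))
      + hG.yosidaExp m s (-(hG.yosidaExp n (t - s) (hG.yosida n x))) = _
    rw [h3, map_sub, map_sub, map_neg, ← sub_eq_add_neg]
  have h := norm_image_sub_le_of_norm_deriv_le_segment' hd
    (C := ‖hG.yosida m x - hG.yosida n x‖) (fun s hs =>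
      (hG.norm_yosidaExp_le m hs.1 _).trans (hG.norm_yosidaExp_le n (sub_nonneg.2 hs.2.le) _))
    t ⟨ht, le_rfl⟩
  simpa [yosidaExp_zero, mul_comm] using h

/-- An `ε/3` argument: for `x'` in the domain near `x`, the sequence `A_n x'` converges and
`norm_yosidaExp_sub_le` applies; the two errors from `x - x'` are controlled by contractivity. -/
lemma uniformCauchySeqOn_yosidaExp (x : E) (t : ℝ) :
    UniformCauchySeqOn (fun n s => hG.yosidaExp n s x) atTop (Icc 0 t) := by
  rw [Metric.uniformCauchySeqOn_iff]
  intro ε hε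
  obtain ⟨x', ⟨y, hxy⟩, hx⟩ := hG.dense_domain.exists_dist_lt x (ε := ε / 3) (by positivity)
  have h1 : CauchySeq fun n => hG.yosida n x' := by
    simp only [hG.yosida_apply _ hxy]
    exact (hG.tendsto_regularization y).cauchySeq
  obtain ⟨N, hN⟩ := Metric.cauchySeq_iff.1 h1 (ε / 3 / (|t| + 1)) (by positivity)
  refine ⟨N, fun m hm n hn s hs => ?_⟩
  have h2 := hN m hm n hn
  have h3 := hG.norm_yosidaExp_sub_le m n hs.1 x'
  rw [dist_eq_norm] at h2 hx ⊢
  have h4 : s * ‖hG.yosida m x' - hG.yosida n x'‖ ≤ ε / 3 := by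
    rw [lt_div_iff₀ (by positivity)] at h2
    have : s ≤ |t| + 1 := hs.2.trans ((le_abs_self t).trans (by linarith))
    nlinarith [norm_nonneg (hG.yosida m x' - hG.yosida n x')]
  have h5 := hG.norm_yosidaExp_le m hs.1 (x - x')
  have h6 := hG.norm_yosidaExp_le n hs.1 (x - x')
  have h7 : hG.yosidaExp m s x - hG.yosidaExp n s x = hG.yosidaExp m s (x - x')
      + (hG.yosidaExp m s x' - hG.yosidaExp n s x') - hG.yosidaExp n s (x - x') := by
    rw [map_sub, map_sub]; abel
  rw [h7]
  have h8 := norm_sub_le (hG.yosidaExp m s (x - x')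
      + (hG.yosidaExp m s x' - hG.yosidaExp n s x')) (hG.yosidaExp n s (x - x'))
  have h9 := norm_add_le (hG.yosidaExp m s (x - x')) (hG.yosidaExp m s x' - hG.yosidaExp n s x')
  linarith

lemma exists_semigroup : ∃ S : ℝ → E →L[ℂ] E,
    ∀ x t, 0 ≤ t → TendstoUniformlyOn (fun n s => hG.yosidaExp n s x) (fun s => S s x) atTop
      (Icc 0 t) := by
  have h1 : ∀ t : ℝ, ∀ x, ∃ y, Tendsto (fun n => hG.yosidaExp n (max t 0) x) atTop (𝓝 y) := by
    intro t x
    exact cauchySeq_tendsto_of_complete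
      ((hG.uniformCauchySeqOn_yosidaExp x (max t 0)).cauchySeq ⟨le_max_right _ _, le_rfl⟩)
  choose f hf using h1
  -- The family is indexed by all real times; for `t < 0` it takes the irrelevant value at `0`,
  -- since nothing is known to converge there.
  refine ⟨fun t => continuousLinearMapOfTendsto (fun n => hG.yosidaExp n (max t 0)) (f := f t)
    (tendsto_pi_nhds.2 (hf t)), fun x t ht => ?_⟩
  refine (hG.uniformCauchySeqOn_yosidaExp x t).tendstoUniformlyOn_of_tendsto fun s hs => ?_
  have h2 := hf s x
  rw [max_eq_left hs.1] at h2
  exact h2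

/-- The semigroup generated by an m-dissipative operator. -/
def semigroup : ℝ → E →L[ℂ] E := hG.exists_semigroup.choose

lemma tendstoUniformlyOn_semigroup (x : E) {t : ℝ} (ht : 0 ≤ t) :
    TendstoUniformlyOn (fun n s => hG.yosidaExp n s x) (fun s => hG.semigroup s x) atTop
      (Icc 0 t) := hG.exists_semigroup.choose_spec x t ht

lemma tendsto_semigroup (x : E) {t : ℝ} (ht : 0 ≤ t) :
    Tendsto (fun n => hG.yosidaExp n t x) atTop (𝓝 (hG.semigroup t x)) :=
  (hG.tendstoUniformlyOn_semigroup x ht).tendsto_at ⟨ht, le_rfl⟩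

lemma norm_semigroup_apply_le {t : ℝ} (ht : 0 ≤ t) (x : E) : ‖hG.semigroup t x‖ ≤ ‖x‖ :=
  le_of_tendsto (hG.tendsto_semigroup x ht).norm
    (Eventually.of_forall fun n => hG.norm_yosidaExp_le n ht x)

/-- Contractivity uniform in `n` allows the argument to move along with the operator; this is what
passes products and varying data to the limit. -/
lemma tendsto_yosidaExp_of_tendsto {u : ℕ → E} {x : E} (hu : Tendsto u atTop (𝓝 x)) {t : ℝ}
    (ht : 0 ≤ t) : Tendsto (fun n => hG.yosidaExp n t (u n)) atTop (𝓝 (hG.semigroup t x)) := by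
  have h1 : Tendsto (fun n => hG.yosidaExp n t (u n - x)) atTop (𝓝 0) := by
    refine squeeze_zero_norm (fun n => hG.norm_yosidaExp_le n ht _) ?_
    simpa using (tendsto_iff_norm_sub_tendsto_zero.1 hu)
  have h2 := h1.add (hG.tendsto_semigroup x ht)
  simpa using h2

lemma semigroup_zero : hG.semigroup 0 = 1 := by
  ext x
  refine tendsto_nhds_unique (hG.tendsto_semigroup x le_rfl) ?_
  simp only [yosidaExp_zero]
  exact tendsto_const_nhds

lemma semigroup_add {s t : ℝ} (hs : 0 ≤ s) (ht : 0 ≤ t) :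
    hG.semigroup (s + t) = hG.semigroup s * hG.semigroup t := by
  ext x
  refine tendsto_nhds_unique (hG.tendsto_semigroup x (add_nonneg hs ht)) ?_
  simp only [yosidaExp_add]
  exact hG.tendsto_yosidaExp_of_tendsto (hG.tendsto_semigroup x ht) hs

lemma continuousOn_semigroup (x : E) : ContinuousOn (fun t => hG.semigroup t x) (Ici 0) := by
  intro t ht
  have h1 : ContinuousOn (fun t => hG.semigroup t x) (Icc 0 (t + 1)) :=
    (hG.tendstoUniformlyOn_semigroup x (t := t + 1) (by linarith [mem_Ici.1 ht])).continuousOn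
      (Frequently.of_forall fun n => (hG.continuous_yosidaExp_apply n x).continuousOn)
  have h2 := h1 t ⟨ht, by linarith⟩
  refine h2.mono_of_mem_nhdsWithin ?_
  rw [mem_nhdsWithin]
  exact ⟨Iio (t + 1), isOpen_Iio, by simp, fun s hs => ⟨hs.2, le_of_lt hs.1⟩⟩

lemma intervalIntegrable_semigroup (x : E) {a b : ℝ} (ha : 0 ≤ a) (hb : 0 ≤ b) :
    IntervalIntegrable (fun t => hG.semigroup t x) volume a b :=
  ((hG.continuousOn_semigroup x).mono fun _ hs => (le_min ha hb).trans hs.1).intervalIntegrable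

lemma tendsto_integral_yosidaExp {u : ℕ → E} {x : E} (hu : Tendsto u atTop (𝓝 x)) {t : ℝ}
    (ht : 0 ≤ t) : Tendsto (fun n => ∫ s in (0 : ℝ)..t, hG.yosidaExp n s (u n)) atTop
      (𝓝 (∫ s in (0 : ℝ)..t, hG.semigroup s x)) := by
  obtain ⟨C, hC⟩ := hu.norm.bddAbove_range
  refine intervalIntegral.tendsto_integral_filter_of_dominated_convergence (fun _ => C)
    (Eventually.of_forall fun n => (hG.continuous_yosidaExp_apply n _).aestronglyMeasurable)
    (Eventually.of_forall fun n => Eventually.of_forall fun s hs => ?_)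
    intervalIntegrable_const (Eventually.of_forall fun s hs => ?_)
  · rw [uIoc_of_le ht] at hs
    exact (hG.norm_yosidaExp_le n hs.1.le _).trans (hC (mem_range_self n))
  · rw [uIoc_of_le ht] at hs
    exact hG.tendsto_yosidaExp_of_tendsto hu hs.1.le

lemma integral_yosidaExp (n : ℕ) (x : E) (t : ℝ) :
    ∫ s in (0 : ℝ)..t, hG.yosidaExp n s (hG.yosida n x) = hG.yosidaExp n t x - x := by
  rw [intervalIntegral.integral_eq_sub_of_hasDerivAt
    (fun s _ => hG.hasDerivAt_yosidaExp_apply n s x)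
    ((hG.continuous_yosidaExp_apply n _).intervalIntegrable _ _)]
  simp [yosidaExp_zero]

/-- The integrated equation for data in the domain. -/
lemma semigroup_sub {x y : E} (h : (x, y) ∈ G) {t : ℝ} (ht : 0 ≤ t) :
    hG.semigroup t x - x = ∫ s in (0 : ℝ)..t, hG.semigroup s y := by
  have h1 := hG.tendsto_integral_yosidaExp (hG.tendsto_regularization y) ht
  refine tendsto_nhds_unique ?_ h1
  simp only [← hG.yosida_apply _ h, integral_yosidaExp]
  exact (hG.tendsto_semigroup x ht).sub_const x

/-- The integrated equation for arbitrary data. -/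
lemma integral_semigroup_mem (x : E) {t : ℝ} (ht : 0 ≤ t) :
    (∫ s in (0 : ℝ)..t, hG.semigroup s x, hG.semigroup t x - x) ∈ G := by
  have h1 := hG.tendsto_integral_yosidaExp (tendsto_const_nhds (x := x)) ht
  have h2 : Tendsto (fun n => hG.regularization n (∫ s in (0 : ℝ)..t, hG.yosidaExp n s x)) atTop
      (𝓝 (∫ s in (0 : ℝ)..t, hG.semigroup s x)) := by
    have h3 : Tendsto (fun n => hG.regularization n ((∫ s in (0 : ℝ)..t, hG.yosidaExp n s x)
        - ∫ s in (0 : ℝ)..t, hG.semigroup s x)) atTop (𝓝 0) :=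
      squeeze_zero_norm (fun n => hG.norm_regularization_le n _)
        (tendsto_iff_norm_sub_tendsto_zero.1 h1)
    simpa using h3.add (hG.tendsto_regularization (∫ s in (0 : ℝ)..t, hG.semigroup s x))
  have h3 : ∀ n, hG.yosida n (∫ s in (0 : ℝ)..t, hG.yosidaExp n s x) = hG.yosidaExp n t x - x := by
    intro n
    rw [← ContinuousLinearMap.intervalIntegral_comp_comm _
      ((hG.continuous_yosidaExp_apply n x).intervalIntegrable _ _), ← hG.integral_yosidaExp]
    refine intervalIntegral.integral_congr fun s _ => ?_
    exact (DFunLike.congr_fun (hG.commute_yosidaExp_yosida n n s).eq x).symm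
  -- By `h3`, `J_n` applied to the approximate integral lies in the domain, with image `exp (t A_n)
  -- x - x`; both components converge and the graph is closed.
  refine hG.isClosed_graph.mem_of_tendsto (h2.prodMk_nhds ((hG.tendsto_semigroup x ht).sub_const x))
    (Eventually.of_forall fun n => ?_)
  rw [← h3 n]
  exact hG.regularization_yosida_mem n _

lemma hasDerivWithinAt_semigroup {x y : E} (h : (x, y) ∈ G) {t : ℝ} (ht : 0 ≤ t) :
    HasDerivWithinAt (fun t => hG.semigroup t x) (hG.semigroup t y) (Ici 0) t := by
  have h1 : HasDerivWithinAt (fun t => x + ∫ s in (0 : ℝ)..t, hG.semigroup s y)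
      (hG.semigroup t y) (Ici 0) t :=
    (hasDerivWithinAt_integral (hG.continuousOn_semigroup y) ht).const_add x
  refine h1.congr_of_mem (fun s hs => ?_) ht
  rw [← hG.semigroup_sub h hs, add_sub_cancel]

lemma tendsto_semigroup_slope {x y : E} (h : (x, y) ∈ G) :
    Tendsto (fun t : ℝ => ((t⁻¹ : ℝ) : ℂ) • (hG.semigroup t x - x)) (𝓝[>] 0) (𝓝 y) := by
  have h1 := (hG.hasDerivWithinAt_semigroup h le_rfl)
  rw [hasDerivWithinAt_iff_tendsto_slope, semigroup_zero, Ici_sdiff_left] at h1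
  refine h1.congr fun t => ?_
  rw [slope_def_module, semigroup_zero, sub_zero]
  rfl

/-- The operator is the infinitesimal generator of its semigroup. -/
lemma mem_iff_tendsto_semigroup {x y : E} : (x, y) ∈ G ↔
    Tendsto (fun t : ℝ => ((t⁻¹ : ℝ) : ℂ) • (hG.semigroup t x - x)) (𝓝[>] 0) (𝓝 y) := by
  refine ⟨hG.tendsto_semigroup_slope, fun h => ?_⟩
  -- Maximality: `w` in the domain solves `w - A w = x - y`. The difference quotients of `x - w`
  -- then converge to `x - w` itself, while contractivity makes the real part of their inner product
  -- with `x - w` nonpositive. So `x = w`.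
  obtain ⟨w, hw⟩ := hG.range 1 one_pos (x - y)
  rw [Complex.ofReal_one, one_smul] at hw
  have h1 := h.sub (hG.tendsto_semigroup_slope hw)
  have h2 : (inner ℂ (y - (w - (x - y))) (x - w)).re ≤ 0 := by
    have h3 := (Complex.continuous_re.tendsto _).comp (h1.inner (tendsto_const_nhds (x := x - w)))
    refine le_of_tendsto h3 ?_
    filter_upwards [self_mem_nhdsWithin] with t ht
    have ht' : (0 : ℝ) < t := ht
    rw [Function.comp_apply, ← smul_sub, sub_sub_sub_comm, ← map_sub, inner_smul_left,
      Complex.conj_ofReal, Complex.re_ofReal_mul, inner_sub_left, Complex.sub_re, re_inner_self_eq]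
    refine mul_nonpos_of_nonneg_of_nonpos (inv_nonneg.2 ht'.le) ?_
    have h4 : (inner ℂ (hG.semigroup t (x - w)) (x - w)).re ≤ ‖x - w‖ * ‖x - w‖ :=
      ((Complex.re_le_norm _).trans (norm_inner_le_norm _ _)).trans
        (mul_le_mul_of_nonneg_right (hG.norm_semigroup_apply_le ht'.le _) (norm_nonneg _))
    linarith
  have h5 : y - (w - (x - y)) = x - w := by abel
  rw [h5, re_inner_self_eq] at h2
  have h6 : x - w = 0 :=
    norm_eq_zero.1 (pow_eq_zero_iff two_ne_zero |>.1 (le_antisymm h2 (sq_nonneg _)))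
  rw [sub_eq_zero] at h6
  rw [← h6, sub_sub_cancel] at hw
  exact hw

/-- The domain is invariant under the semigroup, which commutes with the operator. -/
lemma semigroup_mem {x y : E} (h : (x, y) ∈ G) {t : ℝ} (ht : 0 ≤ t) :
    (hG.semigroup t x, hG.semigroup t y) ∈ G := by
  rw [hG.mem_iff_tendsto_semigroup]
  have h1 := ((hG.semigroup t).continuous.tendsto y).comp (hG.tendsto_semigroup_slope h)
  refine h1.congr' ?_
  filter_upwards [self_mem_nhdsWithin] with s hs
  have hs' : (0 : ℝ) < s := hs
  have h2 : hG.semigroup t (hG.semigroup s x) = hG.semigroup s (hG.semigroup t x) := by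
    have h3 := hG.semigroup_add ht hs'.le
    rw [add_comm, hG.semigroup_add hs'.le ht] at h3
    exact (DFunLike.congr_fun h3 x).symm
  rw [Function.comp_apply, map_smul, map_sub, h2]

/-- A mild solution with zero data vanishes. -/
lemma eq_zero_of_integral_mem {u : ℝ → E} (hc : ContinuousOn u (Ici 0))
    (h : ∀ t, 0 ≤ t → (∫ s in (0 : ℝ)..t, u s, u t) ∈ G) {t : ℝ} (ht : 0 ≤ t) : u t = 0 := by
  have h1 : ∀ t, 0 ≤ t → (∫ s in (0 : ℝ)..t, u s) = 0 := by
    intro t ht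
    -- The primitive `U` of `u` satisfies `U' = A U` and `U 0 = 0`, so its norm never leaves `0`.
    have h2 := norm_le_of_re_inner_nonpos (u := fun t => ∫ s in (0 : ℝ)..t, u s) (u' := u)
      (fun t ht => (hasDerivWithinAt_integral hc ht).continuousWithinAt)
      (fun t ht => (hasDerivWithinAt_integral hc ht).mono (Ici_subset_Ici.2 ht))
      (fun t ht => hG.dissipative _ _ (h t ht)) ht
    simpa using h2
  have h2 := h t ht
  rw [h1 t ht] at h2
  exact hG.single_valued _ h2

end IsMDissipative
end Abstract
end
noncomputable section

/-! ### Integration by parts for absolutely continuous functions -/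

section AbsolutelyContinuous

lemma AbsolutelyContinuousOnInterval.congr_uIcc {X : Type*} [PseudoMetricSpace X] {f g : ℝ → X}
    {a b : ℝ} (hf : AbsolutelyContinuousOnInterval f a b) (h : EqOn f g (uIcc a b)) :
    AbsolutelyContinuousOnInterval g a b := by
  rw [absolutelyContinuousOnInterval_iff] at hf ⊢
  intro ε hε
  obtain ⟨δ, hδ, h1⟩ := hf ε hε
  refine ⟨δ, hδ, fun E hE hE' => ?_⟩
  refine lt_of_eq_of_lt (Finset.sum_congr rfl fun i hi => ?_) (h1 E hE hE')
  obtain ⟨h2, h3⟩ := hE.1 i hi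
  rw [h h2, h h3]

lemma IntervalIntegrable.absolutelyContinuousOnInterval_primitive {f : ℝ → ℂ} {a b : ℝ}
    (hf : IntervalIntegrable f volume a b) :
    AbsolutelyContinuousOnInterval (fun x => ∫ s in a..x, f s) a b := by
  have hre : IntervalIntegrable (fun x => (f x).re) volume a b := ⟨hf.1.re, hf.2.re⟩
  have him : IntervalIntegrable (fun x => (f x).im) volume a b := ⟨hf.1.im, hf.2.im⟩
  have hconst : ∀ c : ℂ, AbsolutelyContinuousOnInterval (fun _ : ℝ => c) a b := fun c =>
    ((LipschitzWith.const c).lipschitzOnWith (s := uIcc a b)).absolutelyContinuousOnInterval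
  have h1 := ((hre.absolutelyContinuousOnInterval_intervalIntegral left_mem_uIcc).smul
    (hconst 1)).add ((him.absolutelyContinuousOnInterval_intervalIntegral left_mem_uIcc).smul
    (hconst Complex.I))
  refine h1.congr_uIcc fun x hx => ?_
  have hx' : IntervalIntegrable f volume a x :=
    hf.mono_set (uIcc_subset_uIcc left_mem_uIcc hx)
  have h2 : ∫ s in a..x, (f s).re = (∫ s in a..x, f s).re :=
    Complex.reCLM.intervalIntegral_comp_comm hx'
  have h3 : ∫ s in a..x, (f s).im = (∫ s in a..x, f s).im :=
    Complex.imCLM.intervalIntegral_comp_comm hx'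
  simp only [Pi.add_apply, Pi.smul_apply', h2, h3, Complex.real_smul, mul_one]
  exact Complex.re_add_im _

/-- Integration by parts for primitives of integrable functions. -/
lemma integral_mul_add_mul_of_primitive {f g F G : ℝ → ℂ} {l : ℝ} (hl : 0 ≤ l)
    (hf : IntervalIntegrable f volume 0 l) (hg : IntervalIntegrable g volume 0 l)
    (hF : ∀ x ∈ Icc 0 l, F x = F 0 + ∫ s in (0 : ℝ)..x, f s)
    (hG : ∀ x ∈ Icc 0 l, G x = G 0 + ∫ s in (0 : ℝ)..x, g s) :
    ∫ x in (0 : ℝ)..l, (f x * G x + F x * g x) = F l * G l - F 0 * G 0 := by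
  have hu : uIcc 0 l = Icc 0 l := uIcc_of_le hl
  set F' : ℝ → ℂ := fun x => F 0 + ∫ s in (0 : ℝ)..x, f s with hF'
  set G' : ℝ → ℂ := fun x => G 0 + ∫ s in (0 : ℝ)..x, g s with hG'
  have hconst : ∀ c : ℂ, AbsolutelyContinuousOnInterval (fun _ : ℝ => c) 0 l := fun c =>
    ((LipschitzWith.const c).lipschitzOnWith (s := uIcc 0 l)).absolutelyContinuousOnInterval
  have hFc : AbsolutelyContinuousOnInterval F' 0 l :=
    (hconst (F 0)).add hf.absolutelyContinuousOnInterval_primitive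
  have hGc : AbsolutelyContinuousOnInterval G' 0 l :=
    (hconst (G 0)).add hg.absolutelyContinuousOnInterval_primitive
  have hi : IntervalIntegrable (fun x => f x * G' x + F' x * g x) volume 0 l :=
    (hf.mul_continuousOn hGc.continuousOn).add (hg.continuousOn_mul hFc.continuousOn)
  -- The product minus the primitive of its expected derivative is absolutely continuous with zero
  -- derivative almost everywhere, hence constant.
  have h1 := (hFc.smul hGc).sub hi.absolutelyContinuousOnInterval_primitive
  obtain ⟨C, hC⟩ := h1.const_of_ae_hasDerivAt_zero (by
    filter_upwards [hf.ae_hasDerivAt_integral, hg.ae_hasDerivAt_integral,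
      hi.ae_hasDerivAt_integral] with x h2 h3 h4 hx
    have h5 := (((h2 hx 0 left_mem_uIcc).const_add (F 0)).mul
      ((h3 hx 0 left_mem_uIcc).const_add (G 0))).sub (h4 hx 0 left_mem_uIcc)
    refine h5.congr_deriv ?_
    simp only [hF', hG']
    ring)
  have h2 := hC 0 left_mem_uIcc
  have h3 := hC l right_mem_uIcc
  have h4 : ∫ x in (0 : ℝ)..l, (f x * G x + F x * g x)
      = ∫ x in (0 : ℝ)..l, (f x * G' x + F' x * g x) := by
    refine intervalIntegral.integral_congr fun x hx => ?_
    rw [hu] at hx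
    simp only [hF x hx, hG x hx, hF', hG']
  have h5 : F' l = F l := (hF l ⟨hl, le_rfl⟩).symm
  have h6 : G' l = G l := (hG l ⟨hl, le_rfl⟩).symm
  rw [h4, ← h5, ← h6]
  simp only [Pi.sub_apply, smul_eq_mul, Pi.mul_apply, intervalIntegral.integral_same,
    sub_zero] at h2 h3
  rw [← h2] at h3
  have h7 : F' 0 = F 0 := by simp [hF']
  have h8 : G' 0 = G 0 := by simp [hG']
  rw [h7, h8] at h3
  rw [← h3]
  ring

end AbsolutelyContinuous

/-! ### Calculus in `L²(0, ℓ)` and `H¹(0, ℓ)` -/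

namespace RootedMetricTree

lemma inner_L2 {ℓ : ℝ} (hl : 0 ≤ ℓ) (f g : L2 ℓ) :
    inner ℂ f g = ∫ x in (0 : ℝ)..ℓ, g x * (starRingEnd ℂ) (f x) := by
  rw [L2.inner_def, intervalIntegral.integral_of_le hl, integral_Ioc_eq_integral_Ioo]
  rfl

lemma norm_sq_L2 {ℓ : ℝ} (hl : 0 ≤ ℓ) (f : L2 ℓ) :
    ‖f‖ ^ 2 = ∫ x in (0 : ℝ)..ℓ, ‖f x‖ ^ 2 := by
  rw [← re_inner_self_eq, inner_L2 hl]
  have : (fun x => f x * (starRingEnd ℂ) (f x)) = fun x => ((‖f x‖ ^ 2 : ℝ) : ℂ) := by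
    funext x
    rw [Complex.mul_conj, Complex.normSq_eq_norm_sq]
  rw [this, intervalIntegral.integral_ofReal, Complex.ofReal_re]

/-- The constant function, as an element of `L²(0, ℓ)`. -/
def constL2 (ℓ : ℝ) (c : ℂ) : L2 ℓ := Lp.const 2 _ c

lemma constL2_ae (ℓ : ℝ) (c : ℂ) :
    (constL2 ℓ c : ℝ → ℂ) =ᵐ[volume.restrict (Ioo 0 ℓ)] fun _ => c := Lp.coeFn_const 2 _ c

lemma integral_constL2 {ℓ x : ℝ} (hx : x ∈ Icc 0 ℓ) (c : ℂ) :
    ∫ s in (0 : ℝ)..x, constL2 ℓ c s = x * c := by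
  rw [integral_congr_L2 (constL2_ae ℓ c) hx]
  simp

lemma integral_sub_L2 {ℓ : ℝ} (w w' : L2 ℓ) {x : ℝ} (hx : x ∈ Icc 0 ℓ) :
    ∫ s in (0 : ℝ)..x, (w - w' : L2 ℓ) s
      = (∫ s in (0 : ℝ)..x, w s) - ∫ s in (0 : ℝ)..x, w' s := by
  rw [eq_sub_iff_add_eq, ← integral_add_L2 _ _ hx, sub_add_cancel]

lemma inner_constL2 {ℓ : ℝ} (hl : 0 ≤ ℓ) (c : ℂ) (w : L2 ℓ) :
    inner ℂ (constL2 ℓ c) w = (starRingEnd ℂ) c * ∫ s in (0 : ℝ)..ℓ, w s := by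
  rw [inner_L2 hl, ← intervalIntegral.integral_const_mul]
  refine integral_congr_L2 ?_ ⟨hl, le_rfl⟩
  filter_upwards [constL2_ae ℓ c] with x hx
  rw [hx, mul_comm]

/-- The functional `w ↦ ∫₀ˣ w` on `L²(0, ℓ)`. -/
def integralL {ℓ x : ℝ} (hx : x ∈ Icc 0 ℓ) : L2 ℓ →L[ℂ] ℂ where
  toFun w := ∫ s in (0 : ℝ)..x, w s
  map_add' w w' := integral_add_L2 w w' hx
  map_smul' c w := integral_smul_L2 c w hx
  cont := continuous_integral_L2 hx

namespace H1

variable {ℓ : ℝ}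

lemma memLp_fn (hl : 0 ≤ ℓ) (u : H1 ℓ) : MemLp (fn u) 2 (volume.restrict (Ioo 0 ℓ)) := by
  obtain ⟨C, hC⟩ := isCompact_Icc.exists_bound_of_continuousOn (continuousOn_fn hl u)
  refine MemLp.of_bound (((continuousOn_fn hl u).mono
    Ioo_subset_Icc_self).aestronglyMeasurable measurableSet_Ioo) C ?_
  rw [ae_restrict_iff' measurableSet_Ioo]
  exact Eventually.of_forall fun x hx => hC x (Ioo_subset_Icc_self hx)

/-- The inclusion of `H¹(0, ℓ)` in `L²(0, ℓ)`. -/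
def toL2 (hl : 0 ≤ ℓ) : H1 ℓ →ₗ[ℂ] L2 ℓ where
  toFun u := (memLp_fn hl u).toLp
  map_add' u v := (memLp_fn hl u).toLp_add (memLp_fn hl v)
  map_smul' c u := (memLp_fn hl u).toLp_const_smul c

lemma toL2_ae (hl : 0 ≤ ℓ) (u : H1 ℓ) :
    (toL2 hl u : ℝ → ℂ) =ᵐ[volume.restrict (Ioo 0 ℓ)] fn u := (memLp_fn hl u).coeFn_toLp

lemma eq_toL2 (hl : 0 ≤ ℓ) {u : H1 ℓ} {w : L2 ℓ}
    (h : (w : ℝ → ℂ) =ᵐ[volume.restrict (Ioo 0 ℓ)] fn u) : w = toL2 hl u :=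
  Lp.ext (h.trans (toL2_ae hl u).symm)

/-- Integration by parts in `H¹(0, ℓ)`. -/
lemma inner_deriv_add (hl : 0 ≤ ℓ) (u w : H1 ℓ) :
    inner ℂ (deriv u) (toL2 hl w) + inner ℂ (toL2 hl u) (deriv w)
      = fn w ℓ * (starRingEnd ℂ) (fn u ℓ) - fn w 0 * (starRingEnd ℂ) (fn u 0) := by
  have hi : ∀ w : L2 ℓ, IntervalIntegrable (w : ℝ → ℂ) volume 0 ℓ := fun w =>
    intervalIntegrable_L2 w ⟨hl, le_rfl⟩
  have hic : ∀ w : L2 ℓ, IntervalIntegrable (fun x => (starRingEnd ℂ) (w x)) volume 0 ℓ := by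
    intro w
    have h := hi w
    rw [intervalIntegrable_iff] at h ⊢
    exact (Complex.conjCLE : ℂ →L[ℝ] ℂ).integrable_comp h
  have hc : ∀ x ∈ Icc 0 ℓ, (starRingEnd ℂ) (fn u x) = (starRingEnd ℂ) (fn u 0)
      + ∫ s in (0 : ℝ)..x, (starRingEnd ℂ) (deriv u s) := by
    intro x hx
    rw [fn_eq u hx, map_add, intervalIntegral.integral_of_le hx.1,
      intervalIntegral.integral_of_le hx.1, integral_conj]
  have h1 := integral_mul_add_mul_of_primitive hl (hi (deriv w)) (hic (deriv u))
    (fun x hx => fn_eq w hx) hc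
  rw [← h1, inner_L2 hl, inner_L2 hl, integral_congr_L2
    (g := fun x => fn w x * (starRingEnd ℂ) (deriv u x)) _ ⟨hl, le_rfl⟩, integral_congr_L2
    (f := fun x => deriv w x * (starRingEnd ℂ) (toL2 hl u x))
    (g := fun x => deriv w x * (starRingEnd ℂ) (fn u x)) _ ⟨hl, le_rfl⟩, add_comm,
    intervalIntegral.integral_add]
  · refine (hi _).mul_continuousOn ?_
    rw [uIcc_of_le hl]
    exact Complex.continuous_conj.comp_continuousOn (continuousOn_fn hl u)
  · refine (hic _).continuousOn_mul ?_
    rw [uIcc_of_le hl]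
    exact continuousOn_fn hl w
  · filter_upwards [toL2_ae hl u] with x hx
    rw [hx]
  · filter_upwards [toL2_ae hl w] with x hx
    rw [hx]

/-- The element of `H¹(0, ℓ)` with a given derivative and a given value at `0`. -/
lemma exists_primitive (hl : 0 ≤ ℓ) (c : ℂ) (w : L2 ℓ) :
    ∃ u : H1 ℓ, fn u 0 = c ∧ deriv u = w := by
  classical
  have h0 : (0 : ℝ) ∈ Icc 0 ℓ := ⟨le_rfl, hl⟩
  refine ⟨⟨(fun x => if x ∈ Icc 0 ℓ then c + ∫ s in (0 : ℝ)..x, w s else 0, w), fun x hx => ?_,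
    fun x hx => if_neg hx⟩, ?_, rfl⟩
  · simp only [if_pos hx, if_pos h0]
    simp
  · simp only [fn, if_pos h0]
    simp

end H1

end RootedMetricTree
end
noncomputable section
namespace RootedMetricTree

/-! ### Vertices, traces and Green's formula on the tree -/

variable {V : Type*} (T : RootedMetricTree V)

lemma init_ne_term (e : T.Edge) : T.init e ≠ T.term e := by
  have : T.graph.Adj (T.init e) (T.term e) := by
    rw [← SimpleGraph.mem_edgeSet, T.ends e]
    exact e.2
  exact this.ne

lemma mem_adjEdges_iff {e : T.Edge} {k : V} : e ∈ T.adjEdges k ↔ k = T.init e ∨ k = T.term e := by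
  change k ∈ (e : Sym2 V) ↔ _
  rw [← T.ends e, Sym2.mem_iff]

lemma coord_init (e : T.Edge) : T.coord e (T.init e) = 0 := by
  simp only [coord, if_neg (T.init_ne_term e).symm]

lemma coord_term (e : T.Edge) : T.coord e (T.term e) = T.len e := by
  simp only [coord, if_true]

lemma incidence_eq_zero {e : T.Edge} {k : V} (h : e ∉ T.adjEdges k) : T.incidence k e = 0 := by
  rw [mem_adjEdges_iff, not_or] at h
  simp only [incidence, if_neg (Ne.symm h.1), if_neg (Ne.symm h.2)]

lemma not_isInterior_root : ¬ T.IsInterior T.root := not_not.2 T.root_exterior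

lemma edgeAt_mem (k : V) : T.edgeAt k ∈ T.adjEdges k := (T.adjEdges_nonempty k).some_mem

lemma eq_edgeAt {k : V} (hk : T.IsLeaf k) {e : T.Edge} (he : e ∈ T.adjEdges k) :
    e = T.edgeAt k := by
  obtain ⟨a, ha⟩ := Set.ncard_eq_one.1 hk.1
  have h2 := T.edgeAt_mem k
  rw [ha, mem_singleton_iff] at he h2
  rw [h2, he]

section Boundary

variable [Finite V]

/-- The sum over the vertices decomposes into masses, leaves and the root. -/
lemma sum_vertices [Fintype V] (c : V → ℂ) :
    ∑ k, c k = c T.root + (∑ k : T.Mass, c k + ∑ k : T.Leaf, c k) := by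
  classical
  rw [← Finset.sum_subtype (Finset.univ.filter T.IsInterior) (by simp) c,
    ← Finset.sum_subtype (Finset.univ.filter T.IsLeaf) (by simp) c,
    ← Finset.add_sum_erase _ _ (Finset.mem_univ T.root), ← Finset.sum_union]
  · congr 2
    ext k
    have := T.not_isInterior_root
    simp only [Finset.mem_erase, Finset.mem_univ, and_true, Finset.mem_union, Finset.mem_filter,
      true_and, IsLeaf, IsInterior] at this ⊢
    by_cases hk : k = T.root
    · subst hk
      tauto
    · tauto
  · rw [Finset.disjoint_filter]
    intro k _ h1 h2
    exact h1 h2.1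

/-- Rearrangement of the boundary terms of the edges into fluxes at the vertices. -/
lemma sum_boundary (f : T.Edge → ℝ → ℂ) (a : V → ℂ) (ha : a T.root = 0) :
    ∑ e, (f e (T.len e) * a (T.term e) - f e 0 * a (T.init e))
      = ∑ k : T.Mass, (∑ e, T.incidence k e * f e (T.coord e k)) * a k
        + ∑ k : T.Leaf, (T.incidence k (T.edgeAt k) * f (T.edgeAt k) (T.coord (T.edgeAt k) k)) * a k
      := by
  classical
  cases nonempty_fintype V
  -- The incidence matrix vanishes away from the two ends of `e`, so the boundary term is a sum over
  -- all vertices and the two summations can be exchanged. The root drops out through `ha`.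
  have h1 : ∀ e, f e (T.len e) * a (T.term e) - f e 0 * a (T.init e)
      = ∑ k, T.incidence k e * f e (T.coord e k) * a k := by
    intro e
    have hne := T.init_ne_term e
    rw [Finset.sum_eq_add_of_mem (T.term e) (T.init e) (Finset.mem_univ _) (Finset.mem_univ _)
      hne.symm, coord_term, coord_init]
    · simp only [incidence, if_true, if_neg hne.symm]
      ring
    · intro k _ hk
      rw [T.incidence_eq_zero, zero_mul, zero_mul]
      rw [mem_adjEdges_iff]
      tauto
  simp only [h1]
  rw [Finset.sum_comm]
  simp only [← Finset.sum_mul]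
  rw [T.sum_vertices, ha, mul_zero, zero_add]
  congr 1
  refine Finset.sum_congr rfl fun k _ => ?_
  rw [Finset.sum_eq_single (T.edgeAt k)]
  · intro e _ he
    rw [T.incidence_eq_zero, zero_mul]
    exact fun h => he (T.eq_edgeAt k.2 h)
  · intro h
    exact absurd (Finset.mem_univ _) h

end Boundary

namespace VSpace

variable {T}

lemma fn_len_eq_val (y : T.VSpace) (e : T.Edge) : y.fn e (T.len e) = y.val (T.term e) := by
  rw [← y.fn_coord (T.mem_adjEdges_iff.2 (Or.inr rfl)), coord_term]

/-- The element of `V` with given values at the vertices and given derivatives. -/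
lemma exists_of_val_deriv (a : V → ℂ) (ha : a T.root = 0) (w : ∀ e : T.Edge, L2 (T.len e))
    (hw : ∀ e, ∫ s in (0 : ℝ)..T.len e, w e s = a (T.term e) - a (T.init e)) :
    ∃ y : T.VSpace, (∀ k, y.val k = a k) ∧ ∀ e, y.deriv e = w e := by
  choose u hu hu' using fun e => H1.exists_primitive (T.len_pos e).le (a (T.init e)) (w e)
  have hval : ∀ k, ∀ e ∈ T.adjEdges k, H1.fn (u e) (T.coord e k) = a k := by
    intro k e he
    rcases T.mem_adjEdges_iff.1 he with rfl | rfl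
    · rw [coord_init, hu]
    · rw [coord_term, H1.fn_eq _ ⟨(T.len_pos e).le, le_rfl⟩, hu, hu', hw]
      ring
  let y : T.VSpace := ⟨u, fun e he => (hval _ e he).trans ha, fun k _ e he e' he' =>
    (hval k e he).trans (hval k e' he').symm⟩
  exact ⟨y, fun k => hval k _ (T.edgeAt_mem k), hu'⟩

variable [Finite V]

lemma norm_deriv_le (y : T.VSpace) (e : T.Edge) : ‖y.deriv e‖ ≤ ‖y‖ :=
  PiLp.norm_apply_le (derivₗ y) e

/-- A Poincaré-type bound: the value is zero at the root, and along a walk from the root to `k` each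
edge changes it by the integral of the derivative, a bounded functional. -/
lemma exists_norm_val_le (k : V) : ∃ C : ℝ, ∀ y : T.VSpace, ‖y.val k‖ ≤ C * ‖y‖ := by
  have hw : ∀ a b : V, T.graph.Walk a b → (∃ C : ℝ, ∀ y : T.VSpace, ‖y.val a‖ ≤ C * ‖y‖) →
      ∃ C : ℝ, ∀ y : T.VSpace, ‖y.val b‖ ≤ C * ‖y‖ := by
    intro a b w
    induction w with
    | nil => exact id
    | @cons a b _ hab _ ih =>
      rintro ⟨C, hC⟩
      refine ih ?_
      set e : T.Edge := ⟨s(a, b), hab⟩ with he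
      have hl : T.len e ∈ Icc 0 (T.len e) := ⟨(T.len_pos e).le, le_rfl⟩
      have key : ∀ y : T.VSpace, y.val (T.term e)
          = y.val (T.init e) + integralL hl (y.deriv e) := by
        intro y
        rw [← fn_len_eq_val, ← fn_zero_eq_val]
        exact y.fn_eq e hl
      have hbd : ∀ y : T.VSpace, ‖integralL hl (y.deriv e)‖ ≤ ‖integralL hl‖ * ‖y‖ := fun y =>
        (ContinuousLinearMap.le_opNorm _ _).trans
          (mul_le_mul_of_nonneg_left (y.norm_deriv_le e) (norm_nonneg _))
      refine ⟨C + ‖integralL hl‖, fun y => ?_⟩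
      rw [add_mul]
      have hends : (T.init e = a ∧ T.term e = b) ∨ (T.init e = b ∧ T.term e = a) := by
        have := T.ends e
        simpa [he] using this
      rcases hends with ⟨h1, h2⟩ | ⟨h1, h2⟩
      · have h3 := key y
        rw [h1, h2] at h3
        rw [h3]
        exact (norm_add_le _ _).trans (add_le_add (hC y) (hbd y))
      · have h3 := key y
        rw [h1, h2, ← sub_eq_iff_eq_add] at h3
        rw [← h3]
        exact (norm_sub_le _ _).trans (add_le_add (hC y) (hbd y))
  obtain ⟨w⟩ := T.isTree.1.preconnected T.root k
  exact hw _ _ w ⟨0, fun y => by simp [val_root]⟩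

/-- The value at a vertex, as a continuous functional. -/
def valL (k : V) : T.VSpace →L[ℂ] ℂ :=
  LinearMap.mkContinuousOfExistsBound
    { toFun := fun y => y.val k, map_add' := fun y z => val_add y z k,
      map_smul' := fun c y => val_smul c y k } (exists_norm_val_le k)

lemma exists_norm_fn_le (e : T.Edge) :
    ∃ C : ℝ, ∀ y : T.VSpace, ∀ x ∈ Icc 0 (T.len e), ‖y.fn e x‖ ≤ C * ‖y‖ := by
  refine ⟨‖valL (T := T) (T.init e)‖ + √(T.len e), fun y x hx => ?_⟩
  rw [y.fn_eq e hx, fn_zero_eq_val, add_mul]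
  refine (norm_add_le _ _).trans (add_le_add ((valL (T.init e)).le_opNorm y) ?_)
  have h1 : ‖∫ s in (0 : ℝ)..x, y.deriv e s‖ ≤ √(T.len e) * ‖y.deriv e‖ := by
    have hs : (volume.restrict (Ioo (0 : ℝ) (T.len e))) (Ioo 0 x) ≠ ⊤ := measure_ne_top _ _
    have h2 : ∫ s in (0 : ℝ)..x, y.deriv e s = inner ℂ (indicatorConstLp 2
        (measurableSet_Ioo (a := (0 : ℝ)) (b := x)) hs (1 : ℂ)) (y.deriv e) := by
      rw [L2.inner_indicatorConstLp_one, Measure.restrict_restrict measurableSet_Ioo,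
        inter_eq_left.2 (Ioo_subset_Ioo_right hx.2), intervalIntegral.integral_of_le hx.1,
        integral_Ioc_eq_integral_Ioo]
    rw [h2]
    refine (norm_inner_le_norm _ _).trans (mul_le_mul_of_nonneg_right ?_ (norm_nonneg _))
    rw [norm_indicatorConstLp two_ne_zero ENNReal.ofNat_ne_top, norm_one, one_mul,
      ENNReal.toReal_ofNat, ← Real.sqrt_eq_rpow]
    refine Real.sqrt_le_sqrt ?_
    rw [Measure.real, Measure.restrict_apply measurableSet_Ioo,
      inter_eq_left.2 (Ioo_subset_Ioo_right hx.2), Real.volume_Ioo,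
      ENNReal.toReal_ofReal (by linarith [hx.1])]
    linarith [hx.2]
  exact h1.trans (mul_le_mul_of_nonneg_left (y.norm_deriv_le e) (Real.sqrt_nonneg _))

/-- The inclusion `V → L²(0, len e)`, as a continuous operator. -/
def toL2 (e : T.Edge) : T.VSpace →L[ℂ] L2 (T.len e) :=
  LinearMap.mkContinuousOfExistsBound
    { toFun := fun y => H1.toL2 (T.len_pos e).le (y.comp e)
      map_add' := fun y z => map_add (H1.toL2 (T.len_pos e).le) (y.comp e) (z.comp e)
      map_smul' := fun c y => map_smul (H1.toL2 (T.len_pos e).le) c (y.comp e) } (by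
    obtain ⟨C, hC⟩ := exists_norm_fn_le e
    refine ⟨(measureUnivNNReal (volume.restrict (Ioo 0 (T.len e))) : ℝ) ^
       (2 : ENNReal).toReal⁻¹ * C,
      fun y => ?_⟩
    rw [mul_assoc]
    refine Lp.norm_le_of_ae_bound ((norm_nonneg _).trans (hC y 0 ⟨le_rfl, (T.len_pos e).le⟩)) ?_
    have h := H1.toL2_ae (T.len_pos e).le (y.comp e)
    filter_upwards [h, ae_restrict_mem measurableSet_Ioo] with x hx hx'
    refine le_trans (le_of_eq ?_) (hC y x (Ioo_subset_Icc_self hx'))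
    exact congrArg norm hx)

lemma inner_eq (y z : T.VSpace) : inner ℂ y z = ∑ e, inner ℂ (y.deriv e) (z.deriv e) := rfl

/-- Green's formula on the tree. -/
lemma sum_inner_deriv_add (u : T.VSpace) (d : ∀ e : T.Edge, H1 (T.len e)) :
    ∑ e, (inner ℂ (u.deriv e) (H1.toL2 (T.len_pos e).le (d e))
        + inner ℂ (toL2 e u) (H1.deriv (d e)))
      = ∑ k : T.Mass, (∑ e, T.incidence k e * H1.fn (d e) (T.coord e k)) *
          (starRingEnd ℂ) (u.val k)
        + ∑ k : T.Leaf, (T.incidence k (T.edgeAt k) *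
          H1.fn (d (T.edgeAt k)) (T.coord (T.edgeAt k) k)) * (starRingEnd ℂ) (u.val k) := by
  rw [← T.sum_boundary (fun e => H1.fn (d e)) (fun k => (starRingEnd ℂ) (u.val k))
    (by rw [val_root, map_zero])]
  refine Finset.sum_congr rfl fun e _ => ?_
  rw [← fn_zero_eq_val, ← fn_len_eq_val]
  exact H1.inner_deriv_add (T.len_pos e).le (u.comp e) (d e)

end VSpace

/-! ### Energy and dissipation -/

section Dissipativity

variable {T} [Finite V]

lemma State.inner_eq (z w : T.State) : inner ℂ z w = ∑ e, inner ℂ (z.y.deriv e) (w.y.deriv e)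
    + (∑ e, inner ℂ (z.v e) (w.v e) + (∑ k, w.p k * (starRingEnd ℂ) (z.p k)
      + ∑ k, w.q k * (starRingEnd ℂ) (z.q k))) := rfl

/-- The energy is half the square of the norm. -/
lemma State.energy_eq (z : T.State) : z.energy = (1 / 2) * ‖z‖ ^ 2 := by
  have hl : ∀ e : T.Edge, 0 ≤ T.len e := fun e => (T.len_pos e).le
  have hi : ∀ (e : T.Edge) (w : L2 (T.len e)),
      IntervalIntegrable (fun x => ‖w x‖ ^ 2) volume 0 (T.len e) := by
    intro e w
    rw [intervalIntegrable_iff_integrableOn_Ioo_of_le (hl e)]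
    exact (memLp_two_iff_integrable_sq_norm (Lp.aestronglyMeasurable w)).1 (Lp.memLp w)
  have h1 : ∀ c : ℂ, (c * (starRingEnd ℂ) c).re = ‖c‖ ^ 2 := by
    intro c
    rw [Complex.mul_conj, Complex.ofReal_re, Complex.normSq_eq_norm_sq]
  rw [← re_inner_self_eq, State.inner_eq, energy]
  simp only [Complex.add_re, Complex.re_sum, re_inner_self_eq, h1]
  simp only [intervalIntegral.integral_add (hi _ _) (hi _ _), ← norm_sq_L2 (hl _),
    Finset.sum_add_distrib]
  ring

/-- The dissipation law. -/
lemma IsImage.re_inner {z Z : T.State} {dy : ∀ e : T.Edge, H1 (T.len e)} (h : T.IsImage z Z dy) :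
    (inner ℂ Z z).re = - ∑ k : T.Leaf, ‖Z.y.val k‖ ^ 2 := by
  have hy : ∀ e, z.y.deriv e = H1.toL2 (T.len_pos e).le (dy e) := fun e =>
    H1.eq_toL2 _ (h.deriv_y e)
  have hv : ∀ e, z.v e = VSpace.toL2 e Z.y := fun e => H1.eq_toL2 (T.len_pos e).le (h.v_eq e)
  -- Green's formula pairs the velocity `Z.y` with the flux `dy`; the vertex conditions in `h`
  -- evaluate its boundary terms.
  have hg := Z.y.sum_inner_deriv_add dy
  have hre : ∀ e, (inner ℂ (Z.v e) (z.v e)).re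
      = (inner ℂ (VSpace.toL2 e Z.y) (H1.deriv (dy e))).re := by
    intro e
    rw [hv, h.snd_eq, ← inner_conj_symm, Complex.conj_re]
  have h1 := congrArg Complex.re hg
  rw [State.inner_eq]
  simp only [h.transmission, h.feedback, Finset.sum_add_distrib] at h1
  simp only [Complex.add_re, Complex.re_sum, hre, hy, h.p_eq, h.q_eq] at h1 ⊢
  rw [← add_assoc, h1, ← Finset.sum_neg_distrib, add_assoc, add_left_comm, ← Finset.sum_add_distrib,
    ← Finset.sum_add_distrib]
  -- At a mass, the power delivered by the flux cancels the change of energy of the oscillator.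
  have h2 : ∀ k : T.Mass, (z.q k * (starRingEnd ℂ) (Z.y.val k)).re +
      ((z.p k * (starRingEnd ℂ) (z.q k)).re
        + (z.q k * (starRingEnd ℂ) (- z.p k - Z.y.val k)).re) = 0 := by
    intro k
    simp only [Complex.mul_re, map_sub, map_neg, Complex.sub_re, Complex.neg_re, Complex.sub_im,
      Complex.neg_im, Complex.conj_re, Complex.conj_im]
    ring
  rw [Finset.sum_eq_zero fun k _ => h2 k, add_zero]
  refine Finset.sum_congr rfl fun k _ => ?_
  rw [neg_mul, Complex.neg_re, Complex.mul_conj, Complex.ofReal_re, Complex.normSq_eq_norm_sq]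

end Dissipativity
end RootedMetricTree
end
noncomputable section
namespace RootedMetricTree

/-! ### Solving the resolvent equation -/

section Range

variable {V : Type*} {T : RootedMetricTree V}

lemma H1.toL2_eq_add_constL2 {ℓ : ℝ} (hl : 0 ≤ ℓ) {u w : H1 ℓ} (h : H1.deriv u = H1.deriv w) :
    H1.toL2 hl u = H1.toL2 hl w + constL2 ℓ (H1.fn u 0 - H1.fn w 0) := by
  refine Lp.ext ?_
  filter_upwards [H1.toL2_ae hl u, H1.toL2_ae hl w, constL2_ae ℓ (H1.fn u 0 - H1.fn w 0),
    Lp.coeFn_add (H1.toL2 hl w) (constL2 ℓ (H1.fn u 0 - H1.fn w 0)),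
    ae_restrict_mem measurableSet_Ioo] with x h1 h2 h3 h4 hx
  rw [h4, Pi.add_apply, h1, h2, h3, H1.fn_eq u (Ioo_subset_Icc_self hx),
    H1.fn_eq w (Ioo_subset_Icc_self hx), h]
  ring

variable [Finite V]

/-- A vector orthogonal to the derivatives of all elements of `V` that vanish at the vertices is
constant on each edge. -/
lemma exists_eq_constL2 (f : ∀ e : T.Edge, L2 (T.len e))
    (h : ∀ φ : T.VSpace, (∀ k, φ.val k = 0) → ∑ e, inner ℂ (φ.deriv e) (f e) = 0) (e : T.Edge) :
    ∃ c, f e = constL2 (T.len e) c := by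
  classical
  have hl : T.len e ∈ Icc 0 (T.len e) := ⟨(T.len_pos e).le, le_rfl⟩
  -- `c` is the mean of `f e`. The remainder `g` has mean zero, so it is the derivative on `e` of a
  -- test function vanishing at all vertices and with zero derivative on the other edges.
  set c : ℂ := (T.len e : ℂ)⁻¹ * ∫ s in (0 : ℝ)..T.len e, f e s with hc
  have hne : (T.len e : ℂ) ≠ 0 := Complex.ofReal_ne_zero.2 (T.len_pos e).ne'
  set g : L2 (T.len e) := f e - constL2 (T.len e) c with hg
  have hg0 : ∫ s in (0 : ℝ)..T.len e, g s = 0 := by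
    rw [hg, integral_sub_L2 _ _ hl, integral_constL2 hl, hc, mul_inv_cancel_left₀ hne, sub_self]
  obtain ⟨φ, hφ, hφ'⟩ := VSpace.exists_of_val_deriv (T := T) (fun _ => 0) rfl (Pi.single e g) (by
    intro e'
    rw [sub_self]
    rcases eq_or_ne e' e with rfl | hne
    · rw [Pi.single_eq_same, hg0]
    · rw [Pi.single_eq_of_ne hne]
      exact integral_zero_L2 ⟨(T.len_pos e').le, le_rfl⟩)
  have h1 := h φ hφ
  simp only [hφ'] at h1
  rw [Finset.sum_eq_single e (fun e' _ hne => by rw [Pi.single_eq_of_ne hne, inner_zero_left])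
    (fun h => absurd (Finset.mem_univ _) h), Pi.single_eq_same] at h1
  have h2 : inner ℂ g (constL2 (T.len e) c) = 0 := by
    rw [← inner_conj_symm, inner_constL2 hl.1, hg0, mul_zero, map_zero]
  -- `⟨g, g⟩ = ⟨g, f e⟩ - ⟨g, c⟩`: the first term vanishes by the hypothesis on test functions, the
  -- second because `g` has mean zero.
  refine ⟨c, sub_eq_zero.1 (inner_self_eq_zero (𝕜 := ℂ).1 ?_)⟩
  rw [← hg]
  nth_rewrite 2 [hg]
  rw [inner_sub_right, h1, h2, sub_zero]

/-- The regularity of weak solutions: they have second derivatives and satisfy the natural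
conditions at the vertices. -/
lemma exists_strong_of_weak (y : T.VSpace) (G : ∀ e : T.Edge, L2 (T.len e)) (c : T.Mass → ℂ)
    (c' : T.Leaf → ℂ)
    (h : ∀ φ : T.VSpace, inner ℂ φ y + ∑ e, inner ℂ (VSpace.toL2 e φ) (G e)
      = ∑ k : T.Mass, c k * (starRingEnd ℂ) (φ.val k)
        + ∑ k : T.Leaf, c' k * (starRingEnd ℂ) (φ.val k)) :
    ∃ d : ∀ e : T.Edge, H1 (T.len e), (∀ e, y.deriv e = H1.toL2 (T.len_pos e).le (d e)) ∧
      (∀ e, H1.deriv (d e) = G e) ∧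
      (∀ k : T.Mass, ∑ e, T.incidence k e * H1.fn (d e) (T.coord e k) = c k) ∧
      ∀ k : T.Leaf, T.incidence k (T.edgeAt k) *
        H1.fn (d (T.edgeAt k)) (T.coord (T.edgeAt k) k) = c' k := by
  classical
  -- Du Bois-Reymond argument: tests vanishing at the vertices show that `y'` differs from a
  -- primitive of `G` by a constant on each edge. The constant is then absorbed into the initial
  -- value of `d`.
  choose d₀ hd₀ hd₀' using fun e => H1.exists_primitive (T.len_pos e).le 0 (G e)
  choose C hC using exists_eq_constL2 (fun e => y.deriv e - H1.toL2 (T.len_pos e).le (d₀ e)) (by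
    intro φ hφ
    have h1 := h φ
    have h2 := φ.sum_inner_deriv_add d₀
    simp only [hφ, map_zero, mul_zero, Finset.sum_const_zero, add_zero, hd₀',
      Finset.sum_add_distrib] at h1 h2
    simp only [inner_sub_right, Finset.sum_sub_distrib]
    rw [VSpace.inner_eq] at h1
    linear_combination h1 - h2)
  choose d hd hd' using fun e => H1.exists_primitive (T.len_pos e).le (C e) (G e)
  have hy : ∀ e, y.deriv e = H1.toL2 (T.len_pos e).le (d e) := by
    intro e
    rw [H1.toL2_eq_add_constL2 (T.len_pos e).le ((hd' e).trans (hd₀' e).symm), hd, hd₀, sub_zero,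
      ← hC, add_sub_cancel]
  have key : ∀ φ : T.VSpace,
      ∑ k : T.Mass, (∑ e, T.incidence k e * H1.fn (d e) (T.coord e k) - c k) *
          (starRingEnd ℂ) (φ.val k)
        + ∑ k : T.Leaf, (T.incidence k (T.edgeAt k) *
          H1.fn (d (T.edgeAt k)) (T.coord (T.edgeAt k) k) - c' k) * (starRingEnd ℂ) (φ.val k)
      = 0 := by
    intro φ
    have h1 := h φ
    have h2 := φ.sum_inner_deriv_add d
    simp only [← hy, hd', Finset.sum_add_distrib] at h2
    rw [← VSpace.inner_eq, h1] at h2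
    simp only [sub_mul, Finset.sum_sub_distrib]
    rw [sub_add_sub_comm, ← h2, sub_self]
  -- Hat functions, affine on each edge, isolate the vertex condition at a single vertex.
  have htest : ∀ k₀, k₀ ≠ T.root → ∃ φ : T.VSpace, ∀ k, φ.val k = if k = k₀ then 1 else 0 := by
    intro k₀ hk₀
    obtain ⟨φ, hφ, -⟩ := VSpace.exists_of_val_deriv (T := T) (fun k => if k = k₀ then 1 else 0)
      (if_neg hk₀.symm) (fun e => constL2 (T.len e) ((T.len e : ℂ)⁻¹ *
        ((if T.term e = k₀ then 1 else 0) - if T.init e = k₀ then 1 else 0))) (fun e => by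
        rw [integral_constL2 ⟨(T.len_pos e).le, le_rfl⟩,
          mul_inv_cancel_left₀ (Complex.ofReal_ne_zero.2 (T.len_pos e).ne')])
    exact ⟨φ, hφ⟩
  refine ⟨d, hy, hd', fun k => ?_, fun k => ?_⟩
  · obtain ⟨φ, hφ⟩ := htest k (fun h => T.not_isInterior_root (h ▸ k.2))
    have h1 := key φ
    have h2 : ∀ D : T.Leaf → ℂ, ∑ k', D k' * (starRingEnd ℂ) (φ.val k') = 0 := by
      refine fun D => Finset.sum_eq_zero fun k' _ => ?_
      rw [hφ, if_neg, map_zero, mul_zero]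
      intro h2
      exact k.2 (h2 ▸ k'.2.1)
    rw [h2, add_zero, Finset.sum_eq_single k, hφ, if_pos rfl, map_one, mul_one, sub_eq_zero] at h1
    · exact h1
    · intro k' _ hk'
      rw [hφ, if_neg (fun h2 => hk' (Subtype.ext h2)), map_zero, mul_zero]
    · exact fun h => absurd (Finset.mem_univ _) h
  · obtain ⟨φ, hφ⟩ := htest k k.2.2
    have h1 := key φ
    rw [Finset.sum_eq_zero, Finset.sum_eq_single k, hφ, if_pos rfl, map_one, mul_one, zero_add,
      sub_eq_zero] at h1
    · exact h1
    · intro k' _ hk'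
      rw [hφ, if_neg (fun h2 => hk' (Subtype.ext h2)), map_zero, mul_zero]
    · exact fun h => absurd (Finset.mem_univ _) h
    · intro k' _
      rw [hφ, if_neg, map_zero, mul_zero]
      intro h2
      exact k'.2 (h2 ▸ k.2.1)

open ContinuousLinearMap in
/-- The solvability of the weak stationary problem. -/
lemma exists_weak {a b c : ℝ} (ha : 0 ≤ a) (hb : 0 ≤ b) (hc : 0 ≤ c)
    (F : ∀ e : T.Edge, L2 (T.len e)) (r : T.Mass → ℂ) (r' : T.Leaf → ℂ) :
    ∃ y : T.VSpace, ∀ φ : T.VSpace,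
      inner ℂ φ y + (∑ e, a * inner ℂ (VSpace.toL2 e φ) (VSpace.toL2 e y)
        + (∑ k : T.Mass, b * (y.val k * (starRingEnd ℂ) (φ.val k))
        + ∑ k : T.Leaf, c * (y.val k * (starRingEnd ℂ) (φ.val k))))
      = ∑ e, inner ℂ (VSpace.toL2 e φ) (F e) + (∑ k : T.Mass, r k * (starRingEnd ℂ) (φ.val k)
        + ∑ k : T.Leaf, r' k * (starRingEnd ℂ) (φ.val k)) := by
  let B : T.VSpace →L[ℂ] T.VSpace := 1 + (∑ e, (a : ℂ) • (adjoint (VSpace.toL2 e) ∘L VSpace.toL2 e)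
    + (∑ k : T.Mass, (b : ℂ) • (adjoint (VSpace.valL (k : V)) ∘L VSpace.valL (k : V))
    + ∑ k : T.Leaf, (c : ℂ) • (adjoint (VSpace.valL (k : V)) ∘L VSpace.valL (k : V))))
  have hB : ∀ y φ : T.VSpace, inner ℂ φ (B y) =
      inner ℂ φ y + (∑ e, a * inner ℂ (VSpace.toL2 e φ) (VSpace.toL2 e y)
        + (∑ k : T.Mass, b * (y.val k * (starRingEnd ℂ) (φ.val k))
        + ∑ k : T.Leaf, c * (y.val k * (starRingEnd ℂ) (φ.val k)))) := by
    intro y φ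
    simp only [B, add_apply, sum_apply, smul_apply, one_apply_eq_self, comp_apply,
      inner_add_right, inner_sum, inner_smul_right, adjoint_inner_right]
    rfl
  have hu : IsUnit B := by
    -- Lax–Milgram: `B` is the identity plus nonnegative operators of the form `A* A`, so it is
    -- coercive with constant `1`.
    refine ContinuousLinearMap.isUnit_of_forall_le_norm_inner_map B (c := 1) one_pos fun y => ?_
    rw [NNReal.coe_one, mul_one, ← inner_conj_symm, RCLike.norm_conj, hB]
    refine le_trans ?_ (Complex.re_le_norm _)
    have hn : ∀ w : ℂ, (w * (starRingEnd ℂ) w).re = ‖w‖ ^ 2 := fun w => by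
      rw [Complex.mul_conj, Complex.ofReal_re, Complex.normSq_eq_norm_sq]
    simp only [Complex.add_re, Complex.re_sum, Complex.re_ofReal_mul, re_inner_self_eq, hn]
    rw [le_add_iff_nonneg_right]
    positivity
  obtain ⟨y, hy⟩ := (ContinuousLinearMap.isUnit_iff_bijective.1 hu).2
    (∑ e, adjoint (VSpace.toL2 e) (F e) + (∑ k : T.Mass, adjoint (VSpace.valL (k : V)) (r k)
      + ∑ k : T.Leaf, adjoint (VSpace.valL (k : V)) (r' k)))
  refine ⟨y, fun φ => ?_⟩
  rw [← hB, hy]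
  simp only [inner_add_right, inner_sum, adjoint_inner_right]
  rfl

/-- A state with given components. -/
def State.mk (y : T.VSpace) (v : ∀ e : T.Edge, L2 (T.len e)) (p q : T.Mass → ℂ) : T.State :=
  WithLp.toLp 2 (y, WithLp.toLp 2 (WithLp.toLp 2 v,
    WithLp.toLp 2 (WithLp.toLp 2 p, WithLp.toLp 2 q)))

/-- The first and third components of `l z - 𝒜z = w` give `v = l y - w.y` and `p = (q + w.p) / l`.
The fourth then gives `(l² + 1) q = l w.q - w.p - l v(a_k)`, leaving a problem for `y` alone. -/
lemma exists_resolvent_eq {l : ℝ} (hl : 0 < l) (w : T.State) :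
    ∃ z : T.State, (z, (l : ℂ) • z - w) ∈ T.generatorGraph := by
  have hl' : (l : ℂ) ≠ 0 := Complex.ofReal_ne_zero.2 hl.ne'
  have hl2 : ((l : ℂ) ^ 2 + 1) ≠ 0 := by
    have : (0 : ℝ) < l ^ 2 + 1 := by positivity
    exact_mod_cast this.ne'
  -- With `v = l y - w.y` substituted, the `y` terms of `l v`, of `-q` and of `v` at the leaves have
  -- coefficients `l²`, `l² / (l² + 1)` and `l`; the remaining terms form the right side.
  obtain ⟨y, hy⟩ := exists_weak (T := T) (a := l ^ 2) (b := l ^ 2 / (l ^ 2 + 1)) (c := l)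
    (by positivity) (by positivity) hl.le (fun e => (l : ℂ) • VSpace.toL2 e w.y + w.v e)
    (fun k => (l * w.q k - w.p k + l * w.y.val k) / ((l : ℂ) ^ 2 + 1)) (fun k => w.y.val k)
  set u : T.VSpace := (l : ℂ) • y - w.y with hu
  have huval : ∀ k, u.val k = l * y.val k - w.y.val k := fun k => rfl
  set q : T.Mass → ℂ := fun k => (l * w.q k - w.p k - l * u.val k) / ((l : ℂ) ^ 2 + 1) with hq
  obtain ⟨d, hd, hd', hm, hf⟩ := exists_strong_of_weak y
    (fun e => (l : ℂ) • VSpace.toL2 e u - w.v e) q (fun k => - u.val k) (by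
    intro φ
    have h1 := hy φ
    have h2 : ∀ e, VSpace.toL2 e u = (l : ℂ) • VSpace.toL2 e y - VSpace.toL2 e w.y := fun e => by
      rw [hu, map_sub, map_smul]
    have h3 : ∀ k : T.Mass, q k = (l * w.q k - w.p k + l * w.y.val k) / ((l : ℂ) ^ 2 + 1)
        - ((l ^ 2 / (l ^ 2 + 1) : ℝ) : ℂ) * y.val k := by
      intro k
      simp only [hq, huval]
      push_cast
      field_simp
      ring
    simp only [h2, h3, huval, inner_sub_right, inner_add_right, inner_smul_right,
      Finset.sum_add_distrib, Finset.sum_sub_distrib, sub_mul, neg_sub,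
      Complex.ofReal_pow] at h1 ⊢
    simp only [mul_assoc, mul_sub, Finset.sum_sub_distrib, ← Finset.mul_sum] at h1 ⊢
    linear_combination h1)
  refine ⟨State.mk y (fun e => VSpace.toL2 e u) (fun k => (q k + w.p k) / l) q, d, fun e => ?_,
    fun e => ?_, hm, hf, fun e => (hd' e).symm, fun k => ?_, fun k => ?_⟩
  · change y.deriv e =ᵐ[_] _
    rw [hd e]
    exact H1.toL2_ae _ _
  · exact H1.toL2_ae (T.len_pos e).le (u.comp e)
  · change l * ((q k + w.p k) / l) - w.p k = q k
    field_simp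
    ring
  · change l * q k - w.q k = - ((q k + w.p k) / l) - u.val k
    simp only [hq]
    field_simp
    ring

/-- The operator is m-dissipative. -/
lemma isMDissipative_generatorGraph : IsMDissipative T.generatorGraph where
  single_valued y hy := T.generatorGraph_single_valued (0, y) hy rfl
  dissipative x y h := by
    obtain ⟨d, hd⟩ := h
    rw [IsImage.re_inner hd]
    exact neg_nonpos.2 (Finset.sum_nonneg fun k _ => sq_nonneg _)
  range l hl z := exists_resolvent_eq hl z

end Range
end RootedMetricTree
end
noncomputable section

/-! ### Square integrable functions on the half-line -/

section HalfLine

lemma L2_norm_sq_eq_integral {α : Type*} [MeasurableSpace α] {μ : Measure α} (w : Lp ℂ 2 μ) :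
    ‖w‖ ^ 2 = ∫ x, ‖w x‖ ^ 2 ∂μ := by
  have h : ∀ x, inner ℂ (w x) (w x) = ((‖w x‖ ^ 2 : ℝ) : ℂ) := fun x => by
    rw [inner_self_eq_norm_sq_to_K, Complex.ofReal_pow]
    rfl
  rw [← re_inner_self_eq, L2.inner_def]
  simp only [h]
  rw [integral_complex_ofReal, Complex.ofReal_re]

lemma memLp_Ioi_of_integral_le {f : ℝ → ℂ} (hf : ContinuousOn f (Ici 0)) {C : ℝ}
    (h : ∀ t, 0 ≤ t → ∫ s in (0 : ℝ)..t, ‖f s‖ ^ 2 ≤ C) :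
    MemLp f 2 (volume.restrict (Ioi 0)) ∧ ∫ s in Ioi (0 : ℝ), ‖f s‖ ^ 2 ≤ C := by
  have hc : ContinuousOn (fun s => ‖f s‖ ^ 2) (Ici 0) := hf.norm.pow 2
  have hi : IntegrableOn (fun s => ‖f s‖ ^ 2) (Ioi 0) := by
    refine integrableOn_Ioi_of_intervalIntegral_norm_bounded C 0 (b := fun n : ℕ => (n : ℝ))
      (l := atTop) (fun n => ?_) tendsto_natCast_atTop_atTop (Eventually.of_forall fun n => ?_)
    · exact ((hc.mono Icc_subset_Ici_self).integrableOn_Icc).mono_set Ioc_subset_Icc_self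
    · simpa using h n n.cast_nonneg
  refine ⟨(memLp_two_iff_integrable_sq_norm
    ((hf.mono Ioi_subset_Ici_self).aestronglyMeasurable measurableSet_Ioi)).2 hi, ?_⟩
  refine le_of_tendsto (intervalIntegral_tendsto_integral_Ioi 0 hi tendsto_natCast_atTop_atTop)
    (Eventually.of_forall fun n : ℕ => h n n.cast_nonneg)

/-- The functional is the inner product with the indicator of `(0, t]`. -/
lemma continuous_integral_Ioi {t : ℝ} (ht : 0 ≤ t) :
    Continuous fun w : Lp ℂ 2 (volume.restrict (Ioi (0 : ℝ))) => ∫ s in (0 : ℝ)..t, w s := by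
  have hs : (volume.restrict (Ioi (0 : ℝ))) (Ioc 0 t) ≠ ⊤ :=
    ((Measure.restrict_apply_le _ _).trans_lt measure_Ioc_lt_top).ne
  have h : ∀ w : Lp ℂ 2 (volume.restrict (Ioi (0 : ℝ))), ∫ s in (0 : ℝ)..t, w s
      = inner ℂ (indicatorConstLp 2 (measurableSet_Ioc (a := (0 : ℝ)) (b := t)) hs (1 : ℂ)) w := by
    intro w
    rw [L2.inner_indicatorConstLp_one, Measure.restrict_restrict measurableSet_Ioc,
      inter_eq_left.2 Ioc_subset_Ioi_self, intervalIntegral.integral_of_le ht]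
  simp only [h]
  exact continuous_const.inner continuous_id

/-- The integral is the squared norm of the restriction to `(0, t]`, and restriction is bounded. -/
lemma continuous_integral_norm_sq_Ioi {t : ℝ} (ht : 0 ≤ t) :
    Continuous fun w : Lp ℂ 2 (volume.restrict (Ioi (0 : ℝ))) => ∫ s in (0 : ℝ)..t, ‖w s‖ ^ 2 := by
  have h : ∀ w : Lp ℂ 2 (volume.restrict (Ioi (0 : ℝ))), ∫ s in (0 : ℝ)..t, ‖w s‖ ^ 2
      = ‖LpToLpRestrictCLM ℝ ℂ ℂ (volume.restrict (Ioi (0 : ℝ))) 2 (Ioc 0 t) w‖ ^ 2 := by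
    intro w
    rw [L2_norm_sq_eq_integral, intervalIntegral.integral_of_le ht]
    have h1 : (volume.restrict (Ioi (0 : ℝ))).restrict (Ioc 0 t) = volume.restrict (Ioc 0 t) := by
      rw [Measure.restrict_restrict measurableSet_Ioc, inter_eq_left.2 Ioc_subset_Ioi_self]
    rw [← h1]
    refine integral_congr_ae ?_
    filter_upwards [LpToLpRestrictCLM_coeFn (𝕜 := ℂ) (Ioc 0 t) w] with s hs
    rw [hs]
  simp only [h]
  exact (ContinuousLinearMap.continuous _).norm.pow 2

end HalfLine

namespace RootedMetricTree

/-! ### The semigroup on the tree, traces and the energy identity -/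

section Wellposedness

variable {V : Type*} {T : RootedMetricTree V} [Finite V]

lemma exists_generator_eq_iff (z Z : T.State) :
    (∃ h : z ∈ T.generator.domain, T.generator ⟨z, h⟩ = Z) ↔ (z, Z) ∈ T.generatorGraph := by
  rw [← Submodule.toLinearPMap_graph_eq _ T.generatorGraph_single_valued, LinearPMap.mem_graph_iff]
  refine ⟨fun ⟨h, h'⟩ => ⟨⟨z, h⟩, rfl, h'⟩, ?_⟩
  rintro ⟨⟨x, hx⟩, h1, h2⟩
  obtain rfl : x = z := h1
  exact ⟨hx, h2⟩

variable (T) in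
/-- The semigroup generated by `𝒜`. -/
def flow : ℝ → T.State →L[ℂ] T.State := (isMDissipative_generatorGraph (T := T)).semigroup

/-- The value of the first component at a vertex, as a continuous functional on `H`. -/
def State.valL (k : V) : T.State →L[ℂ] ℂ := VSpace.valL k ∘L WithLp.fstL 2 ℂ _ _

lemma isSolution_flow (z₀ : T.State) : T.IsSolution z₀ (fun t => T.flow t z₀) := by
  have hG := isMDissipative_generatorGraph (T := T)
  refine ⟨hG.continuousOn_semigroup z₀, fun t ht => ?_⟩
  obtain ⟨h, h'⟩ := (exists_generator_eq_iff _ _).2 (hG.integral_semigroup_mem z₀ ht)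
  refine ⟨h, ?_⟩
  refine Eq.trans ?_ (congrArg (z₀ + ·) h').symm
  exact (add_sub_cancel z₀ _).symm

/-- The difference of two mild solutions with the same data is a mild solution with zero data. -/
lemma IsSolution.eqOn {z₀ : T.State} {z z' : ℝ → T.State} (h : T.IsSolution z₀ z)
    (h' : T.IsSolution z₀ z') : EqOn z' z (Ici 0) := by
  intro t ht
  have hi : ∀ {z : ℝ → T.State}, ContinuousOn z (Ici 0) → ∀ t, 0 ≤ t →
      IntervalIntegrable z volume 0 t := fun hz t ht => by
    refine (hz.mono ?_).intervalIntegrable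
    rw [uIcc_of_le ht]
    exact Icc_subset_Ici_self
  refine sub_eq_zero.1 (isMDissipative_generatorGraph.eq_zero_of_integral_mem
    (u := fun t => z' t - z t) (h'.1.sub h.1) (fun t ht => ?_) ht)
  obtain ⟨h1, h2⟩ := h.2 t ht
  obtain ⟨h3, h4⟩ := h'.2 t ht
  refine (congrArg (fun a => (a, z' t - z t) ∈ T.generatorGraph)
    (intervalIntegral.integral_sub (hi h'.1 t ht) (hi h.1 t ht))).mpr ?_
  have h5 := (exists_generator_eq_iff _ _).1 ⟨h1, rfl⟩
  have h6 := (exists_generator_eq_iff _ _).1 ⟨h3, rfl⟩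
  have h7 := T.generatorGraph.sub_mem h6 h5
  rw [h2, h4, add_sub_add_left_eq_sub]
  exact h7

lemma isContractionSemigroup_flow : T.IsContractionSemigroup T.flow where
  zero := isMDissipative_generatorGraph.semigroup_zero
  add _ _ hs ht := isMDissipative_generatorGraph.semigroup_add hs ht
  continuousOn z := isMDissipative_generatorGraph.continuousOn_semigroup z
  norm_le t ht := ContinuousLinearMap.opNorm_le_bound _ zero_le_one fun z => by
    rw [one_mul]
    exact isMDissipative_generatorGraph.norm_semigroup_apply_le ht z

lemma generates_flow : T.Generates T.flow := fun z Z =>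
  (exists_generator_eq_iff z Z).trans isMDissipative_generatorGraph.mem_iff_tendsto_semigroup

lemma isClassicalSolution_flow {z₀ Z₀ : T.State} (h : (z₀, Z₀) ∈ T.generatorGraph) :
    T.IsClassicalSolution z₀ (fun t => T.flow t z₀) (fun t => T.flow t Z₀) where
  initial := by
    simp only [isContractionSemigroup_flow.zero, one_apply_eq_self]
  continuousOn := isContractionSemigroup_flow.continuousOn z₀
  continuousOn_image := isContractionSemigroup_flow.continuousOn Z₀
  mem_domain t ht :=
    (exists_generator_eq_iff _ _).2 (isMDissipative_generatorGraph.semigroup_mem h ht)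
  hasDeriv t ht := isMDissipative_generatorGraph.hasDerivWithinAt_semigroup h ht

/-- When `Z₀ = 𝒜 z₀`, the first component of `S(t) Z₀ = 𝒜 S(t) z₀` is the velocity of the solution,
so these values are its boundary traces. -/
lemma continuousOn_val_flow (k : V) (Z₀ : T.State) :
    ContinuousOn (fun t => (T.flow t Z₀).y.val k) (Ici 0) :=
  (State.valL k).continuous.comp_continuousOn (isContractionSemigroup_flow.continuousOn Z₀)

/-- The energy identity for data in the domain. -/
lemma energy_sub_of_mem {z₀ Z₀ : T.State} (h : (z₀, Z₀) ∈ T.generatorGraph) {t : ℝ} (ht : 0 ≤ t) :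
    z₀.energy - (T.flow t z₀).energy
      = ∑ k : T.Leaf, ∫ s in (0 : ℝ)..t, ‖(T.flow s Z₀).y.val k‖ ^ 2 := by
  have hG := isMDissipative_generatorGraph (T := T)
  have hc : ∀ k : T.Leaf, ContinuousOn (fun s => ‖(T.flow s Z₀).y.val k‖ ^ 2) (uIcc 0 t) := by
    intro k
    rw [uIcc_of_le ht]
    exact ((continuousOn_val_flow (k : V) Z₀).norm.pow 2).mono Icc_subset_Ici_self
  have hd : ∀ s ∈ Ioo (min 0 t) (max 0 t), HasDerivWithinAt (fun s => ‖T.flow s z₀‖ ^ 2)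
      (-(2 * ∑ k : T.Leaf, ‖(T.flow s Z₀).y.val k‖ ^ 2)) (Ioi s) s := by
    intro s hs
    rw [min_eq_left ht] at hs
    obtain ⟨d, hd⟩ := hG.semigroup_mem h hs.1.le
    have h1 := hasDerivWithinAt_norm_sq ((hG.hasDerivWithinAt_semigroup h hs.1.le).mono
      (Ioi_subset_Ici hs.1.le))
    refine h1.congr_deriv ?_
    rw [hd.re_inner, mul_neg]
    rfl
  have h1 := intervalIntegral.integral_eq_sub_of_hasDeriv_right (by
    rw [uIcc_of_le ht]
    exact ((isContractionSemigroup_flow.continuousOn z₀).norm.pow 2).mono Icc_subset_Ici_self) hd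
    ((ContinuousOn.neg ((continuousOn_finsetSum _ fun k _ => hc k).const_smul
      (2 : ℝ))).intervalIntegrable)
  rw [intervalIntegral.integral_neg, intervalIntegral.integral_const_mul,
    intervalIntegral.integral_finsetSum fun k _ => (hc k).intervalIntegrable,
    isContractionSemigroup_flow.zero, one_apply_eq_self] at h1
  rw [State.energy_eq, State.energy_eq]
  linarith

/-- The trace identity for data in the domain. -/
lemma val_flow_of_mem {z₀ Z₀ : T.State} (h : (z₀, Z₀) ∈ T.generatorGraph) {t : ℝ} (ht : 0 ≤ t)
    (k : V) : (T.flow t z₀).y.val k = z₀.y.val k + ∫ s in (0 : ℝ)..t, (T.flow s Z₀).y.val k := by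
  have hG := isMDissipative_generatorGraph (T := T)
  have h1 := congrArg (State.valL k) (hG.semigroup_sub h ht)
  rw [map_sub, sub_eq_iff_eq_add'] at h1
  exact h1.trans (congrArg (_ + ·) (ContinuousLinearMap.intervalIntegral_comp_comm (State.valL k)
    (hG.intervalIntegrable_semigroup Z₀ le_rfl ht)).symm)

/-- The traces of the velocity at the leaves are controlled by the initial state. -/
lemma memLp_val_flow {z₀ Z₀ : T.State} (h : (z₀, Z₀) ∈ T.generatorGraph) (k : T.Leaf) :
    MemLp (fun s => (T.flow s Z₀).y.val k) 2 (volume.restrict (Ioi 0)) ∧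
      ∫ s in Ioi (0 : ℝ), ‖(T.flow s Z₀).y.val k‖ ^ 2 ≤ ‖z₀‖ ^ 2 := by
  refine memLp_Ioi_of_integral_le (continuousOn_val_flow (k : V) Z₀) fun t ht => ?_
  have h1 := energy_sub_of_mem h ht
  rw [State.energy_eq, State.energy_eq] at h1
  have h2 := Finset.single_le_sum (f := fun k : T.Leaf =>
    ∫ s in (0 : ℝ)..t, ‖(T.flow s Z₀).y.val k‖ ^ 2) (fun k _ =>
    intervalIntegral.integral_nonneg ht fun s _ => sq_nonneg _) (Finset.mem_univ k)
  simp only [← h1] at h2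
  nlinarith [sq_nonneg ‖z₀‖, sq_nonneg ‖T.flow t z₀‖]

/-- The energy identity and the traces at the leaves for arbitrary data. -/
lemma exists_trace (z₀ : T.State) : ∃ g : T.Leaf → ℝ → ℂ,
    (∀ k t, 0 ≤ t → MemLp (g k) 2 (volume.restrict (Ioc 0 t)) ∧
      (T.flow t z₀).y.val k = z₀.y.val k + ∫ s in (0 : ℝ)..t, g k s) ∧
    ∀ t, 0 ≤ t → z₀.energy - (T.flow t z₀).energy = ∑ k, ∫ s in (0 : ℝ)..t, ‖g k s‖ ^ 2 := by
  -- The data are approximated by `x n = J_n z₀` in the domain, whose images `y n = A_n z₀` provide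
  -- the boundary velocities.
  have hG := isMDissipative_generatorGraph (T := T)
  have hz := hG.tendsto_regularization z₀
  have hmem := fun n => hG.regularization_yosida_mem n z₀
  set x : ℕ → T.State := fun n => hG.regularization n z₀ with hx
  set y : ℕ → T.State := fun n => hG.yosida n z₀ with hy
  let w : T.Leaf → ℕ → Lp ℂ 2 (volume.restrict (Ioi (0 : ℝ))) := fun k n =>
    (memLp_val_flow (hmem n) k).1.toLp
  have hw : ∀ k n, (w k n : ℝ → ℂ) =ᵐ[volume.restrict (Ioi 0)] fun s => (T.flow s (y n)).y.val k :=
    fun k n => (memLp_val_flow (hmem n) k).1.coeFn_toLp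
  have hcauchy : ∀ k, CauchySeq (w k) := by
    intro k
    -- By linearity the difference of two traces is the trace for the data `x m - x n`, which the
    -- energy bound controls.
    have hle : ∀ m n, ‖w k m - w k n‖ ≤ ‖x m - x n‖ := by
      intro m n
      have h1 := T.generatorGraph.sub_mem (hmem m) (hmem n)
      have h2 := (memLp_val_flow h1 k).2
      refine (sq_le_sq₀ (norm_nonneg _) (norm_nonneg _)).1 (le_trans (le_of_eq ?_) h2)
      rw [L2_norm_sq_eq_integral]
      refine integral_congr_ae ?_
      filter_upwards [Lp.coeFn_sub (w k m) (w k n), hw k m, hw k n] with s h3 h4 h5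
      rw [h3, Pi.sub_apply, h4, h5]
      congr 2
      exact (map_sub (State.valL (k : V) ∘L T.flow s) (y m) (y n)).symm
    rw [Metric.cauchySeq_iff]
    intro ε hε
    obtain ⟨N, hN⟩ := Metric.cauchySeq_iff.1 hz.cauchySeq ε hε
    refine ⟨N, fun m hm n hn => ?_⟩
    have h1 := hN m hm n hn
    rw [dist_eq_norm] at h1 ⊢
    exact (hle m n).trans_lt h1
  choose g hg using fun k => cauchySeq_tendsto_of_complete (hcauchy k)
  have hcongr : ∀ k n (t : ℝ), 0 ≤ t →
      ∀ᵐ s ∂volume, s ∈ uIoc 0 t → w k n s = (T.flow s (y n)).y.val k := by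
    intro k n t ht
    have h1 := (ae_restrict_iff' measurableSet_Ioi).1 (hw k n)
    filter_upwards [h1] with s hs hs'
    rw [uIoc_of_le ht] at hs'
    exact hs hs'.1
  refine ⟨fun k => g k, fun k t ht => ⟨?_, ?_⟩, fun t ht => ?_⟩
  · exact (Lp.memLp (g k)).mono_measure (Measure.restrict_mono Ioc_subset_Ioi_self le_rfl)
  · have h1 : Tendsto (fun n => State.valL (k : V) (T.flow t (x n))) atTop
        (𝓝 (State.valL (k : V) (T.flow t z₀))) :=
      (((State.valL (k : V)).comp (T.flow t)).continuous.tendsto z₀).comp hz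
    have h2 : Tendsto (fun n => State.valL (k : V) (x n)) atTop (𝓝 (State.valL (k : V) z₀)) :=
      ((State.valL (k : V)).continuous.tendsto z₀).comp hz
    have h3 := ((continuous_integral_Ioi ht).tendsto (g k)).comp (hg k)
    refine tendsto_nhds_unique h1 ((h2.add h3).congr fun n => ?_)
    refine Eq.trans ?_ (val_flow_of_mem (hmem n) ht k).symm
    exact congrArg (_ + ·) (intervalIntegral.integral_congr_ae (hcongr k n t ht))
  · have h1 : Tendsto (fun n => (x n).energy - (T.flow t (x n)).energy) atTop
        (𝓝 (z₀.energy - (T.flow t z₀).energy)) := by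
      simp only [State.energy_eq]
      exact ((hz.norm.pow 2).const_mul _).sub
        (((((T.flow t).continuous.tendsto z₀).comp hz).norm.pow 2).const_mul _)
    have h2 : Tendsto (fun n => ∑ k, ∫ s in (0 : ℝ)..t, ‖w k n s‖ ^ 2) atTop
        (𝓝 (∑ k, ∫ s in (0 : ℝ)..t, ‖g k s‖ ^ 2)) :=
      tendsto_finsetSum _ fun k _ =>
        ((continuous_integral_norm_sq_Ioi ht).tendsto (g k)).comp (hg k)
    refine tendsto_nhds_unique h1 (h2.congr fun n => ?_)
    rw [energy_sub_of_mem (hmem n) ht]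
    refine Finset.sum_congr rfl fun k _ => intervalIntegral.integral_congr_ae ?_
    filter_upwards [hcongr k n t ht] with s hs hs'
    rw [hs hs']

end Wellposedness
end RootedMetricTree
end

/-! ### The wellposedness theorem -/

theorem mainTheorem7 {V : Type*} [Finite V] (T : RootedMetricTree V) :
    (∀ z₀ : T.State, ∃ z : ℝ → T.State,
      T.IsSolution z₀ z ∧
      (∀ z' : ℝ → T.State, T.IsSolution z₀ z' → EqOn z' z (Ici 0)) ∧
      (∃ g : T.Leaf → ℝ → ℂ,
        (∀ k t, 0 ≤ t → MemLp (g k) 2 (volume.restrict (Ioc 0 t)) ∧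
          (z t).y.val k = z₀.y.val k + ∫ s in (0 : ℝ)..t, g k s) ∧
        ∀ t, 0 ≤ t → (z 0).energy - (z t).energy = ∑ k, ∫ s in (0 : ℝ)..t, ‖g k s‖ ^ 2) ∧
      (z₀ ∈ T.generator.domain → ∃ w : ℝ → T.State,
        T.IsClassicalSolution z₀ z w ∧
        (∀ t, 0 ≤ t → ∀ e, (z t).v e =ᵐ[volume.restrict (Ioo 0 (T.len e))] (w t).y.fn e) ∧
        ∀ t, 0 ≤ t → (z 0).energy - (z t).energy
          = ∑ k : T.Leaf, ∫ s in (0 : ℝ)..t, ‖(w s).y.val k‖ ^ 2)) ∧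
    (∃ S : ℝ → T.State →L[ℂ] T.State,
      T.IsContractionSemigroup S ∧ T.Generates S ∧
      ∀ z₀ : T.State, T.IsSolution z₀ (fun t => S t z₀)) := by
  have h0 : ∀ z₀ : T.State, T.flow 0 z₀ = z₀ := fun z₀ => by
    rw [RootedMetricTree.isContractionSemigroup_flow.zero, one_apply_eq_self]
  refine ⟨fun z₀ => ⟨fun t => T.flow t z₀, RootedMetricTree.isSolution_flow z₀, fun z' h =>
    (RootedMetricTree.isSolution_flow z₀).eqOn h, ?_, fun hz => ?_⟩, T.flow,
    RootedMetricTree.isContractionSemigroup_flow,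
    RootedMetricTree.generates_flow, RootedMetricTree.isSolution_flow⟩
  · simp only [h0]
    exact RootedMetricTree.exists_trace z₀
  · have hmem := (RootedMetricTree.exists_generator_eq_iff z₀ _).1 ⟨hz, rfl⟩
    refine ⟨_, RootedMetricTree.isClassicalSolution_flow hmem, fun t ht e => ?_, fun t ht => ?_⟩
    · obtain ⟨d, hd⟩ := RootedMetricTree.isMDissipative_generatorGraph.semigroup_mem hmem ht
      exact hd.v_eq e
    · simp only [h0]
      exact RootedMetricTree.energy_sub_of_mem hmem ht
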